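/- **Theorem.** Let $M$ be a simply connected smooth surface (a Hausdorff, second countable smooth $2$-manifold without boundary) and let $\nabla$ be a smooth torsion free connection on $TM$. Put $R(X,Y)Z=\nabla_X\nabla_YZ-\nabla_Y\nabla_XZ-\nabla_{[X,Y]}Z$, let $\rho(X,Y)=\operatorname{Tr}\{Z\mapsto R(Z,X)Y\}$ be the Ricci tensor and $\rho_s(X,Y)=\frac12\{\rho(X,Y)+\rho(Y,X)\}$ its symmetrization. We write $\operatorname{Rank}\{\rho_s\}=r$ if $\rho_s$ does not vanish identically on $M$ and, at every point where $\rho_s\neq0$, the bilinear form $\rho_s$ has rank $r$. Let $\mathcal P^0$ be the real vector space of smooth trace free tensor fields $T$ of type $(1,1)$ on $M$ with $\nabla T=0$. We say that $(M,\nabla)$ admits a Kähler structure if there is $T\in\mathcal P^0$ with $T^2=-\operatorname{id}$, a para-Kähler structure if there is $T\in\mathcal P^0$ with $T^2=\operatorname{id}$, and a nilpotent Kähler structure if there is a nilpotent $T\in\mathcal P^0$ with $T\neq0$. 1. If $\dim\mathcal P^0=1$, then exactly one of the following holds: (a) $(M,\nabla)$ admits a Kähler structure and $\operatorname{Rank}\{\rho_s\}=2$;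 (b) $(M,\nabla)$ admits a para-Kähler structure and $\operatorname{Rank}\{\rho_s\}=2$; (c) $(M,\nabla)$ admits a nilpotent Kähler structure and $\operatorname{Rank}\{\rho_s\}=1$. 2. $\dim\mathcal P^0\neq2$. 3. $\dim\mathcal P^0=3$ if and only if $\rho_s=0$ identically on $M$. In this case $(M,\nabla)$ admits Kähler, para-Kähler and nilpotent Kähler structures. -/

import Mathlib

open Bundle VectorField
open scoped Manifold ContDiff Topology

/-! Throughout, a surface is a smooth manifold `M` without boundary, modelled on
`EuclideanSpace ℝ (Fin 2)`. In Mathlib's convention for covariant derivatives,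
`cov Y x (X x)` is `(∇_X Y)(x)`. -/

namespace AffineSurface

noncomputable section

variable (M : Type*) [TopologicalSpace M] [ChartedSpace (EuclideanSpace ℝ (Fin 2)) M]
  [IsManifold (𝓡 2) ∞ M]

/-- A smooth torsion free connection on the tangent bundle of the surface `M`. -/
structure AffineConnection where
  /-- The covariant derivative. -/
  cov : CovariantDerivative (𝓡 2) (EuclideanSpace ℝ (Fin 2)) (TangentSpace (𝓡 2) : M → Type _)
  smooth : cov.ContMDiffCovariantDerivative ∞
  torsion_free : cov.torsion = 0

/-- Smooth tensor fields of type `(1,1)`: smooth sections of the bundle `End(TM)`. -/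
abbrev TensorOneOne : Type _ :=
  ContMDiffSection (𝓡 2) (EuclideanSpace ℝ (Fin 2) →L[ℝ] EuclideanSpace ℝ (Fin 2)) ∞
    (fun x : M => TangentSpace (𝓡 2) x →L[ℝ] TangentSpace (𝓡 2) x)

variable {M}

/-- The vector field `X` is differentiable at `x`. -/
abbrev DiffAt (X : Π x : M, TangentSpace (𝓡 2) x) (x : M) : Prop :=
  MDifferentiableAt (𝓡 2) ((𝓡 2).prod 𝓘(ℝ, EuclideanSpace ℝ (Fin 2)))
    (fun y => TotalSpace.mk' (EuclideanSpace ℝ (Fin 2)) y (X y)) x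

/-- The vector field `X` is smooth on `s`. -/
abbrev SmoothOn (X : Π x : M, TangentSpace (𝓡 2) x) (s : Set M) : Prop :=
  ContMDiffOn (𝓡 2) ((𝓡 2).prod 𝓘(ℝ, EuclideanSpace ℝ (Fin 2))) ∞
    (fun y => TotalSpace.mk' (EuclideanSpace ℝ (Fin 2)) y (X y)) s

/-! ### Curvature and Ricci tensor -/

/-- The operation `(X, Y, Z) ↦ ∇_X ∇_Y Z - ∇_Y ∇_X Z - ∇_[X,Y] Z` on vector fields. -/
def curvatureAux (D : AffineConnection M) (X Y Z : Π x : M, TangentSpace (𝓡 2) x) (x : M) :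
    TangentSpace (𝓡 2) x :=
  D.cov (fun y => D.cov Z y (Y y)) x (X x) - D.cov (fun y => D.cov Z y (X y)) x (Y x)
    - D.cov Z x (mlieBracket (𝓡 2) X Y x)

/-- If `Z` is smooth near `x` and `X` is differentiable at `x`, then `∇_X Z` is differentiable
at `x`. -/
theorem mdifferentiableAt_cov [T2Space M] (D : AffineConnection M)
    {Z : Π x : M, TangentSpace (𝓡 2) x} {s : Set M} {x : M} (hs : IsOpen s) (hx : x ∈ s)
    (hZ : SmoothOn Z s) {X : Π x : M, TangentSpace (𝓡 2) x} (hX : DiffAt X x) :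
    DiffAt (fun y => D.cov Z y (X y)) x := by
  obtain ⟨f, hfs⟩ : ∃ f : SmoothBumpFunction (𝓡 2) x, tsupport f ⊆ s := by
    obtain ⟨f, -, hfs⟩ :=
      (SmoothBumpFunction.nhds_basis_tsupport (I := 𝓡 2) x).mem_iff.1 (hs.mem_nhds hx)
    exact ⟨f, hfs⟩
  have hW : SmoothOn ((f : M → ℝ) • Z) Set.univ :=
    (ContMDiffOn.smul_section_of_tsupport f.contMDiff.contMDiffOn hs hfs hZ).contMDiffOn
  have h1 := D.smooth.contMDiff.contMDiff (σ := (f : M → ℝ) • Z) hW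
  have h2 := (h1.contMDiffAt (x := x) Filter.univ_mem).mdifferentiableAt (by simp)
  have h3 := h2.clm_bundle_apply hX
  refine h3.congr_of_eventuallyEq ?_
  filter_upwards [eventually_eventually_nhds.2 f.eventuallyEq_one, hs.mem_nhds hx] with y hy hys
  congr 2
  refine D.cov.isCovariantDerivativeOnUniv.congr_of_eventuallyEq (s := Set.univ) ?_ ?_ ?_ ?_
  · exact (hZ.contMDiffAt (hs.mem_nhds hys)).mdifferentiableAt (by simp)
  · exact (hW.contMDiffAt Filter.univ_mem).mdifferentiableAt (by simp)
  · simp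
  · filter_upwards [hy] with z hz
    simp [hz]

/-- The extension of `w ∈ T_x M` to the vector field with constant components in the preferred
trivialization of `TM` at `x`. It is smooth near `x`. -/
def extendConst {x : M} (w : TangentSpace (𝓡 2) x) (y : M) : TangentSpace (𝓡 2) y :=
  letI t := trivializationAt (EuclideanSpace ℝ (Fin 2)) (TangentSpace (𝓡 2) : M → Type _) x
  t.symmL ℝ y (t.continuousLinearMapAt ℝ x w)

theorem extendConst_self {x : M} (w : TangentSpace (𝓡 2) x) : extendConst w x = w :=
  Trivialization.symmL_continuousLinearMapAt _ (FiberBundle.mem_baseSet_trivializationAt' x) w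

theorem extendConst_add {x : M} (v w : TangentSpace (𝓡 2) x) :
    extendConst (v + w) = extendConst v + extendConst w := by
  funext y; simp [extendConst]

theorem extendConst_smul {x : M} (c : ℝ) (w : TangentSpace (𝓡 2) x) :
    extendConst (c • w) = c • extendConst w := by
  funext y; simp [extendConst]

theorem exists_smooth_extendConst {x : M} (w : TangentSpace (𝓡 2) x) :
    ∃ s : Set M, IsOpen s ∧ x ∈ s ∧ SmoothOn (extendConst w) s := by
  set t := trivializationAt (EuclideanSpace ℝ (Fin 2)) (TangentSpace (𝓡 2) : M → Type _) x
  have hx : x ∈ t.baseSet := FiberBundle.mem_baseSet_trivializationAt' x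
  refine ⟨t.baseSet, t.open_baseSet, hx, fun y hy => ?_⟩
  rw [t.contMDiffWithinAt_section _ hy]
  have h : ContMDiffOn (𝓡 2) 𝓘(ℝ, EuclideanSpace ℝ (Fin 2)) ∞
      (fun _ : M => t.continuousLinearMapAt ℝ x w) t.baseSet := contMDiffOn_const
  refine (h.congr fun z hz => ?_) y hy
  change (t ⟨z, t.symmL ℝ z (t.continuousLinearMapAt ℝ x w)⟩).2 = _
  rw [t.symmL_apply (R := ℝ) hz, t.apply_mk_symm hz]

theorem tensorial_curvatureAux₁ [T2Space M] (D : AffineConnection M) {x : M}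
    (w : TangentSpace (𝓡 2) x) (Y : Π x : M, TangentSpace (𝓡 2) x) (_hY : DiffAt Y x) :
    TensorialAt (𝓡 2) (EuclideanSpace ℝ (Fin 2))
      (fun X => curvatureAux D X Y (extendConst w) x) x where
  smul {f X} hf hX := by
    obtain ⟨s, hs, hx, hw⟩ := exists_smooth_extendConst w
    have h := D.cov.isCovariantDerivativeOnUniv.leibniz
      (mdifferentiableAt_cov D hs hx hw hX) hf
    have e : (fun y => D.cov (extendConst w) y ((f • X) y))
      = f • fun y => D.cov (extendConst w) y (X y) := by
      ext1 y; simp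
    simp only [curvatureAux, e, h, mlieBracket_smul_left hf hX]
    simp
    module
  add {X X'} hX hX' := by
    obtain ⟨s, hs, hx, hw⟩ := exists_smooth_extendConst w
    have h := D.cov.isCovariantDerivativeOnUniv.add
      (mdifferentiableAt_cov D hs hx hw hX) (mdifferentiableAt_cov D hs hx hw hX')
    have e : (fun y => D.cov (extendConst w) y ((X + X') y))
      = (fun y => D.cov (extendConst w) y (X y)) +
        fun y => D.cov (extendConst w) y (X' y) := by
      ext1 y; simp
    simp only [curvatureAux, e, h, mlieBracket_add_left hX hX']
    simp
    module

theorem curvatureAux_swap (D : AffineConnection M) (X Y Z : Π x : M, TangentSpace (𝓡 2) x)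
    (x : M) : curvatureAux D X Y Z x = - curvatureAux D Y X Z x := by
  simp only [curvatureAux, mlieBracket_swap_apply (V := X), map_neg]
  module

theorem tensorial_curvatureAux₂ [T2Space M] (D : AffineConnection M) {x : M}
    (w : TangentSpace (𝓡 2) x) (X : Π x : M, TangentSpace (𝓡 2) x) (hX : DiffAt X x) :
    TensorialAt (𝓡 2) (EuclideanSpace ℝ (Fin 2))
      (fun Y => curvatureAux D X Y (extendConst w) x) x where
  smul {f Y} hf hY := by
    rw [curvatureAux_swap, (tensorial_curvatureAux₁ D w X hX).smul hf hY, curvatureAux_swap D X]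
    module
  add {Y Y'} hY hY' := by
    rw [curvatureAux_swap, (tensorial_curvatureAux₁ D w X hX).add hY hY', curvatureAux_swap D X,
      curvatureAux_swap D X]
    module

/-- The curvature tensor: `curvature D w u v = R(u, v) w`, where
`R(X, Y) Z = ∇_X ∇_Y Z - ∇_Y ∇_X Z - ∇_[X,Y] Z` and `w ∈ T_x M` is extended to the
vector field `extendConst w`. -/
def curvature [T2Space M] (D : AffineConnection M) {x : M} (w : TangentSpace (𝓡 2) x) :
    TangentSpace (𝓡 2) x →L[ℝ] TangentSpace (𝓡 2) x →L[ℝ] TangentSpace (𝓡 2) x :=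
  TensorialAt.mkHom₂ (fun X Y => curvatureAux D X Y (extendConst w) x) x
    (tensorial_curvatureAux₁ D w) (tensorial_curvatureAux₂ D w)

theorem mdifferentiableAt_extendConst {x : M} (w : TangentSpace (𝓡 2) x) :
    DiffAt (extendConst w) x := by
  obtain ⟨s, hs, hx, hw⟩ := exists_smooth_extendConst w
  exact (hw.contMDiffAt (hs.mem_nhds hx)).mdifferentiableAt (by simp)

theorem curvature_apply [T2Space M] (D : AffineConnection M) {x : M} (w : TangentSpace (𝓡 2) x)
    {X Y : Π x : M, TangentSpace (𝓡 2) x} (hX : DiffAt X x) (hY : DiffAt Y x) :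
    curvature D w (X x) (Y x) = curvatureAux D X Y (extendConst w) x :=
  TensorialAt.mkHom₂_apply (tensorial_curvatureAux₁ D w) (tensorial_curvatureAux₂ D w) hX hY

theorem curvature_eq [T2Space M] (D : AffineConnection M) {x : M} (u v w : TangentSpace (𝓡 2) x) :
    curvature D w u v = curvatureAux D (extendConst u) (extendConst v) (extendConst w) x := by
  rw [← curvature_apply D w (mdifferentiableAt_extendConst u) (mdifferentiableAt_extendConst v),
    extendConst_self, extendConst_self]

theorem cov_cov_add [T2Space M] (D : AffineConnection M) {Z W : Π x : M, TangentSpace (𝓡 2) x}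
    {s : Set M} {x : M} (hs : IsOpen s) (hx : x ∈ s) (hZ : SmoothOn Z s) (hW : SmoothOn W s)
    {X : Π x : M, TangentSpace (𝓡 2) x} (hX : DiffAt X x) :
    D.cov (fun y => D.cov (Z + W) y (X y)) x =
      D.cov (fun y => D.cov Z y (X y)) x + D.cov (fun y => D.cov W y (X y)) x := by
  have hd {V : Π x : M, TangentSpace (𝓡 2) x} (hV : SmoothOn V s) {y : M} (hy : y ∈ s) :
      DiffAt V y := (hV.contMDiffAt (hs.mem_nhds hy)).mdifferentiableAt (by simp)
  rw [← D.cov.isCovariantDerivativeOnUniv.add (mdifferentiableAt_cov D hs hx hZ hX)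
    (mdifferentiableAt_cov D hs hx hW hX)]
  refine D.cov.isCovariantDerivativeOnUniv.congr_of_eventuallyEq (s := Set.univ) ?_ ?_ (by simp) ?_
  · exact mdifferentiableAt_cov D hs hx (hZ.add_section hW) hX
  · exact mdifferentiableAt_add_section (mdifferentiableAt_cov D hs hx hZ hX)
      (mdifferentiableAt_cov D hs hx hW hX)
  · filter_upwards [hs.mem_nhds hx] with y hy
    simp [D.cov.isCovariantDerivativeOnUniv.add (hd hZ hy) (hd hW hy)]

theorem cov_cov_smul [T2Space M] (D : AffineConnection M) {Z : Π x : M, TangentSpace (𝓡 2) x}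
    {s : Set M} {x : M} (hs : IsOpen s) (hx : x ∈ s) (hZ : SmoothOn Z s) (c : ℝ)
    {X : Π x : M, TangentSpace (𝓡 2) x} (hX : DiffAt X x) :
    D.cov (fun y => D.cov (c • Z) y (X y)) x = c • D.cov (fun y => D.cov Z y (X y)) x := by
  have hd {y : M} (hy : y ∈ s) : DiffAt Z y :=
    (hZ.contMDiffAt (hs.mem_nhds hy)).mdifferentiableAt (by simp)
  have h := mdifferentiableAt_cov D hs hx hZ hX
  rw [← D.cov.isCovariantDerivativeOnUniv.smul_const c h]
  refine D.cov.isCovariantDerivativeOnUniv.congr_of_eventuallyEq (s := Set.univ) ?_ ?_ (by simp) ?_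
  · exact mdifferentiableAt_cov D hs hx (hZ.const_smul_section) hX
  · exact mdifferentiableAt_const.smul_section h
  · filter_upwards [hs.mem_nhds hx] with y hy
    simp [D.cov.isCovariantDerivativeOnUniv.smul_const c (hd hy)]

theorem curvature_add [T2Space M] (D : AffineConnection M) {x : M} (w w' : TangentSpace (𝓡 2) x) :
    curvature D (w + w') = curvature D w + curvature D w' := by
  obtain ⟨s, hs, hx, hw⟩ := exists_smooth_extendConst w
  obtain ⟨s', hs', hx', hw'⟩ := exists_smooth_extendConst w'
  have hZ := hw.mono (Set.inter_subset_left (t := s'))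
  have hW := hw'.mono (Set.inter_subset_right (s := s))
  ext u v : 2
  simp only [add_apply, curvature_eq, curvatureAux, extendConst_add]
  rw [cov_cov_add D (hs.inter hs') ⟨hx, hx'⟩ hZ hW (mdifferentiableAt_extendConst u),
    cov_cov_add D (hs.inter hs') ⟨hx, hx'⟩ hZ hW (mdifferentiableAt_extendConst v),
    D.cov.isCovariantDerivativeOnUniv.add (mdifferentiableAt_extendConst w) (mdifferentiableAt_extendConst w')]
  simp only [add_apply]
  abel

theorem curvature_smul [T2Space M] (D : AffineConnection M) {x : M} (c : ℝ)
    (w : TangentSpace (𝓡 2) x) : curvature D (c • w) = c • curvature D w := by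
  obtain ⟨s, hs, hx, hw⟩ := exists_smooth_extendConst w
  ext u v : 2
  simp only [smul_apply, curvature_eq, curvatureAux, extendConst_smul]
  rw [cov_cov_smul D hs hx hw c (mdifferentiableAt_extendConst u),
    cov_cov_smul D hs hx hw c (mdifferentiableAt_extendConst v),
    D.cov.isCovariantDerivativeOnUniv.smul_const c (mdifferentiableAt_extendConst w)]
  simp only [smul_apply, smul_sub]

/-- The endomorphism `z ↦ R(z, v) w` of the tangent space at `x`. -/
def curvatureEndo [T2Space M] (D : AffineConnection M) {x : M} (v w : TangentSpace (𝓡 2) x) :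
    TangentSpace (𝓡 2) x →ₗ[ℝ] TangentSpace (𝓡 2) x where
  toFun z := curvature D w z v
  map_add' := by intro z z'; simp
  map_smul' := by intro c z; simp

/-- The Ricci tensor at `x`: `ρ(v, w) = Tr (z ↦ R(z, v) w)`. -/
def ricci [T2Space M] (D : AffineConnection M) (x : M) :
    TangentSpace (𝓡 2) x →ₗ[ℝ] TangentSpace (𝓡 2) x →ₗ[ℝ] ℝ :=
  LinearMap.mk₂ ℝ
    (fun v w => LinearMap.trace ℝ (TangentSpace (𝓡 2) x) (curvatureEndo D v w))
    (by intro v v' w; rw [← map_add]; congr 1; ext1 z; simp [curvatureEndo])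
    (by intro c v w; rw [← map_smul]; congr 1; ext1 z; simp [curvatureEndo])
    (by intro v w w'; rw [← map_add]; congr 1; ext1 z; simp [curvatureEndo, curvature_add])
    (by intro c v w; rw [← map_smul]; congr 1; ext1 z; simp [curvatureEndo, curvature_smul])

/-- The symmetric Ricci tensor `ρ_s(v, w) = (ρ(v, w) + ρ(w, v)) / 2` at `x`. -/
def ricciSymm [T2Space M] (D : AffineConnection M) (x : M) :
    TangentSpace (𝓡 2) x →ₗ[ℝ] TangentSpace (𝓡 2) x →ₗ[ℝ] ℝ :=
  (1 / 2 : ℝ) • (ricci D x + (ricci D x).flip)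

/-- The rank of the bilinear form `ρ_s` at the point `x`. -/
def ricciSymmRankAt [T2Space M] (D : AffineConnection M) (x : M) : ℕ :=
  Module.finrank ℝ (LinearMap.range (ricciSymm D x))

/-- The tensor field `ρ_s` has rank `r`: it does not vanish identically, and it has rank `r` as a
bilinear form at every point where it does not vanish. -/
def RicciSymmHasRank [T2Space M] (D : AffineConnection M) (r : ℕ) : Prop :=
  (∃ x : M, ricciSymm D x ≠ 0) ∧ ∀ x : M, ricciSymm D x ≠ 0 → ricciSymmRankAt D x = r

/-! ### Parallel tensors of type `(1,1)` -/

/-- `∇T = 0`, i.e. `(∇_v T) X = ∇_v (T X) - T (∇_v X)` vanishes for every tangent vector `v` at `x`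
and every vector field `X` which is differentiable at `x`. -/
def IsParallel (D : AffineConnection M) (T : TensorOneOne M) : Prop :=
  ∀ (X : Π x : M, TangentSpace (𝓡 2) x) (x : M), DiffAt X x →
    ∀ v : TangentSpace (𝓡 2) x, D.cov (fun y => T y (X y)) x v = T x (D.cov X x v)

theorem mdifferentiableAt_tensor (T : TensorOneOne M) {X : Π x : M, TangentSpace (𝓡 2) x} {x : M}
    (hX : DiffAt X x) : DiffAt (fun y => T y (X y)) x :=
  (T.mdifferentiableAt (x := x)).clm_bundle_apply hX

/-- The space of parallel tensors of type `(1,1)`. -/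
def parallelTensors (D : AffineConnection M) : Submodule ℝ (TensorOneOne M) where
  carrier := {T | IsParallel D T}
  zero_mem' := by
    intro X x hX v
    have h := D.cov.zero
    have e : (fun y => (0 : TensorOneOne M) y (X y)) = 0 := by ext1 y; simp
    rw [e, h]; simp
  add_mem' := by
    intro S T hS hT X x hX v
    have e : (fun y => (S + T) y (X y)) = (fun y => S y (X y)) + fun y => T y (X y) := by
      ext1 y; simp
    rw [e, D.cov.isCovariantDerivativeOnUniv.add (mdifferentiableAt_tensor S hX)
      (mdifferentiableAt_tensor T hX)]
    simp [hS X x hX v, hT X x hX v]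
  smul_mem' := by
    intro c T hT X x hX v
    have e : (fun y => (c • T) y (X y)) = c • fun y => T y (X y) := by ext1 y; simp
    rw [e, D.cov.isCovariantDerivativeOnUniv.smul_const c (mdifferentiableAt_tensor T hX)]
    simp [hT X x hX v]

/-- The space of trace free parallel tensors of type `(1,1)`. -/
def traceFreeParallelTensors (D : AffineConnection M) : Submodule ℝ (TensorOneOne M) where
  carrier := {T | T ∈ parallelTensors D ∧
    ∀ x, LinearMap.trace ℝ (TangentSpace (𝓡 2) x) (T x).toLinearMap = 0}
  zero_mem' := ⟨zero_mem _, by intro x; simp⟩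
  add_mem' := by
    rintro S T ⟨hS, hS'⟩ ⟨hT, hT'⟩
    exact ⟨add_mem hS hT, by intro x; simp [hS' x, hT' x]⟩
  smul_mem' := by
    rintro c T ⟨hT, hT'⟩
    exact ⟨Submodule.smul_mem _ c hT, by intro x; simp [hT' x]⟩

/-- A Kähler structure: a trace free parallel `T` with `T² = -id`. -/
def AdmitsKahler (D : AffineConnection M) : Prop :=
  ∃ T ∈ traceFreeParallelTensors D,
    ∀ x, T x ∘L T x = -ContinuousLinearMap.id ℝ (TangentSpace (𝓡 2) x)

/-- A para-Kähler structure: a trace free parallel `T` with `T² = id`. -/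
def AdmitsParaKahler (D : AffineConnection M) : Prop :=
  ∃ T ∈ traceFreeParallelTensors D,
    ∀ x, T x ∘L T x = ContinuousLinearMap.id ℝ (TangentSpace (𝓡 2) x)

/-- A nilpotent Kähler structure: a non-zero trace free parallel `T` with `T x` nilpotent for
all `x`. -/
def AdmitsNilpotentKahler (D : AffineConnection M) : Prop :=
  ∃ T ∈ traceFreeParallelTensors D, T ≠ 0 ∧
    ∀ x, IsNilpotent (T x : TangentSpace (𝓡 2) x →L[ℝ] TangentSpace (𝓡 2) x)

end

end AffineSurface

/-! In a chart, `∇T = 0` is the linear total differential equation `dT = TΓ - ΓT`. Along segments it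
becomes a linear ODE, so on a connected `M` a parallel `T` is determined by its value at one point
(`eq_zero_of_isParallelAt`), and evaluation at a point embeds `𝒫⁰` into the trace free matrices.

In dimension two the curvature at a point is a single operator `A = R(e₀, e₁)` times an area form.
The entries of `ρ_s` are, up to sign, those of the trace free part `A₀` of `A`; the trace of `A`
enters only the skew part of `ρ`. A parallel `T` commutes with `A` (`IsParallelAt.apply_curvature`),
and a trace free matrix commuting with `A` is a multiple of `A₀` as soon as `A₀ ≠ 0`. Hence the
dimension is at most one if `ρ_s` is nonzero somewhere.

If `ρ_s = 0` everywhere, all curvature operators are scalar, so the connection induced on `End(TM)`,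
whose curvature is a commutator, is flat. The total differential equation is then locally solvable
(`exists_hasFDerivAt_flip`), and simple connectivity glues the local solutions
(`exists_section_of_locallyConstant_transition`). Every trace free endomorphism of one tangent space
extends, so the dimension is three. The value two is thus impossible.

By Cayley–Hamilton and uniqueness, `T² = c·id` with one constant `c = -det T` for each `T` in `𝒫⁰`;
the sign of `c` decides the type of structure after rescaling. If `T ≠ 0` and `ρ_s ≠ 0` at `x`, then
`A₀ = lT` there with `l ≠ 0`, and `ρ_s` has determinant `-l²c`: rank two for `c ≠ 0` and rank one
for `c = 0`. -/

/-! ### Linear total differential equations -/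

section LinearTotalODE

set_option maxSynthPendingDepth 3

variable {E W : Type*} [NormedAddCommGroup E] [NormedSpace ℝ E]
  [NormedAddCommGroup W] [NormedSpace ℝ W]

/-- Existence on `[0, 1]` for a linear equation with small coefficients. -/
theorem exists_linear_ode_solution [CompleteSpace W] {B : ℝ → W →L[ℝ] W}
    (hB : ContinuousOn B (Set.Icc 0 1)) (hB' : ∀ t ∈ Set.Icc (0 : ℝ) 1, ‖B t‖ ≤ 1 / 2) (w : W) :
    ∃ γ : ℝ → W, γ 0 = w ∧
      ∀ t ∈ Set.Icc (0 : ℝ) 1, HasDerivWithinAt γ (B t (γ t)) (Set.Icc 0 1) t := by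
  -- On the ball of radius `‖w‖` about `w` one has `‖x‖ ≤ 2‖w‖`, so the bound `1 / 2` on the
  -- coefficients keeps the speed below `‖w‖` and the solution survives for the full unit time.
  have h : IsPicardLindelof (fun t x => B t x) (⟨0, by simp⟩ : Set.Icc (0 : ℝ) 1) w
      ‖w‖₊ 0 ‖w‖₊ 1 := by
    refine ⟨fun t ht => ?_, fun x _ => hB.clm_apply continuousOn_const, fun t ht x hx => ?_, ?_⟩
    · refine (LipschitzWith.weaken (B t).lipschitz ?_).lipschitzOnWith
      rw [← NNReal.coe_le_coe]
      exact (hB' t ht).trans (by norm_num)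
    · have h1 : ‖x‖ ≤ 2 * ‖w‖ := by
        have h2 : ‖x - w‖ ≤ ‖w‖ := by simpa [dist_eq_norm] using hx
        calc ‖x‖ = ‖(x - w) + w‖ := by simp
          _ ≤ _ := (norm_add_le _ _).trans (by linarith)
      calc ‖B t x‖ ≤ 1 / 2 * (2 * ‖w‖) :=
            (B t).le_of_opNorm_le_of_le (hB' t ht) h1
        _ = _ := by simp
    · simp
  obtain ⟨γ, h0, hγ⟩ := h.exists_eq_forall_mem_Icc_hasDerivWithinAt₀
  exact ⟨γ, h0, hγ⟩

/-- A solution of a linear total differential equation on a convex open set which vanishes at one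
point vanishes identically. -/
theorem eqOn_zero_of_hasFDerivAt_flip {V : Set E} (hVc : Convex ℝ V)
    {A : E → E →L[ℝ] W →L[ℝ] W} (hA : ContinuousOn A V) {F : E → W}
    (hF : ∀ p ∈ V, HasFDerivAt F ((A p).flip (F p)) p) {p : E} (hp : p ∈ V) (h0 : F p = 0)
    {q : E} (hq : q ∈ V) : F q = 0 := by
  have hseg : ∀ t ∈ Set.Icc (0 : ℝ) 1, p + t • (q - p) ∈ V := fun t ht =>
    hVc.add_smul_sub_mem hp hq ht
  have hl : ∀ t, HasDerivAt (fun t : ℝ => p + t • (q - p)) (q - p) t := fun t => by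
    simpa using ((hasDerivAt_id t).smul_const (q - p)).const_add p
  have hlc : Continuous (fun t : ℝ => p + t • (q - p)) := by fun_prop
  have hd : ∀ t ∈ Set.Icc (0 : ℝ) 1, HasDerivAt (fun t : ℝ => F (p + t • (q - p)))
      (A (p + t • (q - p)) (q - p) (F (p + t • (q - p)))) t := fun t ht =>
    (hF _ (hseg t ht)).comp_hasDerivAt (f := fun t : ℝ => p + t • (q - p)) t (hl t)
  have hAc : ContinuousOn (fun t : ℝ => A (p + t • (q - p)) (q - p)) (Set.Icc 0 1) :=
    (hA.comp hlc.continuousOn hseg).clm_apply continuousOn_const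
  obtain ⟨K, hK⟩ := isCompact_Icc.exists_bound_of_continuousOn hAc
  have := eq_zero_of_abs_deriv_le_mul_abs_self_of_eq_zero_right (K := K) (a := 0) (b := 1)
    (fun t ht => (hd t ht).continuousAt.continuousWithinAt)
    (fun t ht => (hd t ⟨ht.1, ht.2.le⟩).hasDerivWithinAt) (by simpa using h0)
    (fun t ht => (ContinuousLinearMap.le_opNorm _ _).trans
      (mul_le_mul_of_nonneg_right (hK t ⟨ht.1, ht.2.le⟩) (norm_nonneg _))) 1 (by simp)
  simpa using this

/-- The estimate of the error term in `norm_radial_solution_sub_le`, with `a` and `a'` the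
coefficients at time `t` on the rays of direction `x` and `x + h`, `L` the derivative of the
coefficients on the first ray, and `g` the solution there. Each of the four summands is quadratic in
`h`. -/
theorem norm_radial_remainder_le {a a' : E →L[ℝ] W →L[ℝ] W} {L : E →L[ℝ] E →L[ℝ] W →L[ℝ] W}
    {x h : E} {g : W} {t C G : ℝ} (ht : t ∈ Set.Icc (0 : ℝ) 1)
    (ha : ‖a‖ ≤ C) (hL : ‖L‖ ≤ C) (haa : ‖a' - a‖ ≤ C * ‖h‖)
    (htaylor : ‖a' - a - L (t • h)‖ ≤ C * ‖h‖ ^ 2) (hx : ‖x + h‖ ≤ 1) (hg : ‖g‖ ≤ G) :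
    ‖(a' - a - L (t • h)) (x + h) g + t • (L h h g) + t • ((a' - a) (x + h) (a h g))
      + t • (a h (a h g))‖ ≤ (2 * C + 2 * C ^ 2) * G * ‖h‖ ^ 2 := by
  have hG : 0 ≤ G := (norm_nonneg g).trans hg
  have htn : ‖t‖ ≤ 1 := by rw [Real.norm_of_nonneg ht.1]; exact ht.2
  have hah : ‖a h g‖ ≤ C * ‖h‖ * G :=
    ((a h).le_of_opNorm_le_of_le (a.le_of_opNorm_le_of_le ha le_rfl) hg)
  have e1 : ‖(a' - a - L (t • h)) (x + h) g‖ ≤ C * ‖h‖ ^ 2 * 1 * G :=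
    ContinuousLinearMap.le_of_opNorm_le_of_le _
      (ContinuousLinearMap.le_of_opNorm_le_of_le _ htaylor hx) hg
  have e2 : ‖t • (L h h g)‖ ≤ 1 * (C * ‖h‖ * ‖h‖ * G) := by
    rw [norm_smul]
    exact mul_le_mul htn (ContinuousLinearMap.le_of_opNorm_le_of_le _
      (ContinuousLinearMap.le_of_opNorm_le_of_le _
        (L.le_of_opNorm_le_of_le hL le_rfl) le_rfl) hg) (norm_nonneg _) zero_le_one
  have e3 : ‖t • ((a' - a) (x + h) (a h g))‖ ≤ 1 * (C * ‖h‖ * 1 * (C * ‖h‖ * G)) := by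
    rw [norm_smul]
    exact mul_le_mul htn (ContinuousLinearMap.le_of_opNorm_le_of_le _
      (ContinuousLinearMap.le_of_opNorm_le_of_le _ haa hx) hah) (norm_nonneg _) zero_le_one
  have e4 : ‖t • (a h (a h g))‖ ≤ 1 * (C * ‖h‖ * (C * ‖h‖ * G)) := by
    rw [norm_smul]
    exact mul_le_mul htn (ContinuousLinearMap.le_of_opNorm_le_of_le _
      (a.le_of_opNorm_le_of_le ha le_rfl) hah) (norm_nonneg _) zero_le_one
  refine (norm_add_le_of_le (norm_add_le_of_le (norm_add_le_of_le e1 e2) e3) e4).trans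
    (le_of_eq ?_)
  ring

/-- Comparison of the solutions along two nearby rays: the solution along the ray of direction
`x` depends differentiably on `x`, with the derivative prescribed by a flat total differential
equation. -/
theorem norm_radial_solution_sub_le {p₀ : E} {r C : ℝ}
    {A : E → E →L[ℝ] W →L[ℝ] W} {A' : E → E →L[ℝ] E →L[ℝ] W →L[ℝ] W} (hr : r ≤ 1) (hC : 0 ≤ C)
    (hd : ∀ p ∈ Metric.ball p₀ r, HasFDerivAt A (A' p) p)
    (hA : ∀ p ∈ Metric.ball p₀ r, ‖A p‖ ≤ C) (hA' : ∀ p ∈ Metric.ball p₀ r, ‖A' p‖ ≤ C)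
    (hlip : ∀ p ∈ Metric.ball p₀ r, ∀ q ∈ Metric.ball p₀ r, ‖A q - A p‖ ≤ C * ‖q - p‖)
    (htaylor : ∀ p ∈ Metric.ball p₀ r, ∀ q ∈ Metric.ball p₀ r,
      ‖A q - A p - A' p (q - p)‖ ≤ C * ‖q - p‖ ^ 2)
    (hflat : ∀ p ∈ Metric.ball p₀ r, ∀ u v,
      A' p u v + A p v ∘L A p u = A' p v u + A p u ∘L A p v)
    {x h : E} (hx : ‖x‖ < r) (hxh : ‖x + h‖ < r) {γ γ' : ℝ → W} {G : ℝ}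
    (hγ : ∀ t ∈ Set.Icc (0 : ℝ) 1,
      HasDerivWithinAt γ (A (p₀ + t • x) x (γ t)) (Set.Icc 0 1) t)
    (hγ' : ∀ t ∈ Set.Icc (0 : ℝ) 1,
      HasDerivWithinAt γ' (A (p₀ + t • (x + h)) (x + h) (γ' t)) (Set.Icc 0 1) t)
    (h0 : γ 0 = γ' 0) (hG : ∀ t ∈ Set.Icc (0 : ℝ) 1, ‖γ t‖ ≤ G) :
    ‖γ' 1 - γ 1 - A (p₀ + x) h (γ 1)‖ ≤
      gronwallBound 0 C ((2 * C + 2 * C ^ 2) * G * ‖h‖ ^ 2) 1 := by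
  have hmem : ∀ y : E, ‖y‖ < r → ∀ t ∈ Set.Icc (0 : ℝ) 1, p₀ + t • y ∈ Metric.ball p₀ r := by
    intro y hy t ht
    rw [mem_ball_iff_norm, add_sub_cancel_left, norm_smul, Real.norm_of_nonneg ht.1]
    exact (mul_le_of_le_one_left (norm_nonneg _) ht.2).trans_lt hy
  have hl : ∀ t, HasDerivAt (fun t : ℝ => p₀ + t • x) x t := fun t => by
    simpa using ((hasDerivAt_id t).smul_const x).const_add p₀
  -- If `F` solves the total equation, the variation of `F (p₀ + t • x)` in `x` along `h` is `t • A
  -- h γ`. The difference between `γ' - γ` and this candidate is the defect to be estimated.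
  have hD : ∀ t ∈ Set.Icc (0 : ℝ) 1, HasDerivWithinAt
      (fun t => γ' t - γ t - t • A (p₀ + t • x) h (γ t))
      (A (p₀ + t • (x + h)) (x + h) (γ' t) - A (p₀ + t • x) x (γ t) -
        (t • (A' (p₀ + t • x) x h (γ t) + A (p₀ + t • x) h (A (p₀ + t • x) x (γ t)))
          + (1 : ℝ) • A (p₀ + t • x) h (γ t))) (Set.Icc 0 1) t := by
    intro t ht
    have h1 : HasDerivAt (fun t : ℝ => A (p₀ + t • x)) (A' (p₀ + t • x) x) t :=
      (hd _ (hmem x hx t ht)).comp_hasDerivAt t (hl t)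
    have h2 : HasDerivAt (fun t : ℝ => A (p₀ + t • x) h) (A' (p₀ + t • x) x h) t := by
      simpa using h1.clm_apply (hasDerivAt_const t h)
    exact ((hγ' t ht).sub (hγ t ht)).sub
      ((hasDerivAt_id t).hasDerivWithinAt.smul (h2.hasDerivWithinAt.clm_apply (hγ t ht)))
  have hbound : ∀ t ∈ Set.Ico (0 : ℝ) 1,
      ‖A (p₀ + t • (x + h)) (x + h) (γ' t) - A (p₀ + t • x) x (γ t) -
        (t • (A' (p₀ + t • x) x h (γ t) + A (p₀ + t • x) h (A (p₀ + t • x) x (γ t)))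
          + (1 : ℝ) • A (p₀ + t • x) h (γ t))‖ ≤ C * ‖γ' t - γ t - t • A (p₀ + t • x) h (γ t)‖
      + (2 * C + 2 * C ^ 2) * G * ‖h‖ ^ 2 := by
    intro t ht'
    have ht : t ∈ Set.Icc (0 : ℝ) 1 := ⟨ht'.1, ht'.2.le⟩
    have hp := hmem x hx t ht
    have hq := hmem _ hxh t ht
    have hqp : p₀ + t • (x + h) - (p₀ + t • x) = t • h := by module
    have hth : ‖t • h‖ ≤ ‖h‖ := by
      rw [norm_smul, Real.norm_of_nonneg ht.1]
      exact mul_le_of_le_one_left (norm_nonneg _) ht.2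
    have hrem := norm_radial_remainder_le (x := x) (h := h) (g := γ t) ht (hA _ hp) (hA' _ hp)
      (a' := A (p₀ + t • (x + h)))
      (((hlip _ hp _ hq).trans_eq (by rw [hqp])).trans (mul_le_mul_of_nonneg_left hth hC))
      (by
        have h1 := htaylor _ hp _ hq
        rw [hqp] at h1
        exact h1.trans (by gcongr))
      (hxh.le.trans hr) (hG t ht)
    -- Flatness interchanges `x` and `h`; without it the defect would satisfy an equation with a
    -- term linear in `h`.
    have hfl := congrArg (fun S : W →L[ℝ] W => S (γ t)) (hflat _ hp x h)
    simp only [add_apply, ContinuousLinearMap.comp_apply] at hfl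
    have hmain : ‖A (p₀ + t • (x + h)) (x + h) (γ' t - γ t - t • A (p₀ + t • x) h (γ t))‖ ≤
        C * ‖γ' t - γ t - t • A (p₀ + t • x) h (γ t)‖ := by
      refine ContinuousLinearMap.le_of_opNorm_le _ ?_ _
      simpa using ContinuousLinearMap.le_of_opNorm_le_of_le _ (hA _ hq) (hxh.le.trans hr)
    refine le_trans (le_of_eq (congrArg norm ?_)) (norm_add_le_of_le hmain hrem)
    rw [hfl]
    simp only [map_sub, map_add, map_smul, sub_apply, add_apply, smul_apply]
    module
  have hfin := norm_le_gronwallBound_of_norm_deriv_right_le (a := 0) (b := 1) (δ := 0)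
    (fun t ht => (hD t ht).continuousWithinAt)
    (fun t ht => (hD t ⟨ht.1, ht.2.le⟩).mono_of_mem_nhdsWithin (Icc_mem_nhdsGE_of_mem ht))
    (by simp [h0]) hbound 1 (by simp)
  simpa using hfin

/-- Local solvability of flat linear total differential equations. -/
theorem exists_hasFDerivAt_flip [CompleteSpace W] {V : Set E} (hV : IsOpen V)
    {A : E → E →L[ℝ] W →L[ℝ] W} (hA : ContDiffOn ℝ ∞ A V)
    (hflat : ∀ p ∈ V, ∀ u v,
      fderiv ℝ A p u v + A p v ∘L A p u = fderiv ℝ A p v u + A p u ∘L A p v)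
    {p₀ : E} (hp₀ : p₀ ∈ V) :
    ∃ r > 0, Metric.ball p₀ r ⊆ V ∧ ∀ w, ∃ F : E → W, F p₀ = w ∧
      ∀ p ∈ Metric.ball p₀ r, HasFDerivAt F ((A p).flip (F p)) p := by
  have hAat : ContDiffAt ℝ ∞ A p₀ := hA.contDiffAt (hV.mem_nhds hp₀)
  have hA'at : ContDiffAt ℝ 1 (fderiv ℝ A) p₀ := hAat.fderiv_right (by norm_cast)
  obtain ⟨K, s, hs, hK⟩ := hA'at.exists_lipschitzOnWith
  obtain ⟨K', s', hs', hK'⟩ := (hAat.of_le (by norm_cast) :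
    ContDiffAt ℝ 1 A p₀).exists_lipschitzOnWith
  have e1 : ∀ᶠ p in 𝓝 p₀, ‖A p‖ < ‖A p₀‖ + 1 :=
    hAat.continuousAt.norm.eventually (gt_mem_nhds (by linarith))
  have e2 : ∀ᶠ p in 𝓝 p₀, ‖fderiv ℝ A p‖ < ‖fderiv ℝ A p₀‖ + 1 :=
    hA'at.continuousAt.norm.eventually (gt_mem_nhds (by linarith))
  obtain ⟨R, hR, hball⟩ := Metric.eventually_nhds_iff_ball.1
    ((((e1.and e2).and hs).and hs').and (hV.mem_nhds hp₀))
  obtain ⟨C, hC⟩ : ∃ C : ℝ, C = ‖A p₀‖ + ‖fderiv ℝ A p₀‖ + K + K' + 1 := ⟨_, rfl⟩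
  have n1 := norm_nonneg (A p₀)
  have n2 := norm_nonneg (fderiv ℝ A p₀)
  have n3 := K.2
  have n4 := K'.2
  have hC1 : 1 ≤ C := by rw [hC]; linarith [K.coe_nonneg, K'.coe_nonneg]
  have hC0 : 0 < C := by linarith
  obtain ⟨r, hr⟩ : ∃ r : ℝ, r = min R (1 / (2 * C)) := ⟨_, rfl⟩
  have hrR : r ≤ R := hr ▸ min_le_left _ _
  have hrC : r ≤ 1 / (2 * C) := hr ▸ min_le_right _ _
  have hr0 : 0 < r := by rw [hr]; positivity
  have hCr : C * r ≤ 1 / 2 := by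
    calc C * r ≤ C * (1 / (2 * C)) := by gcongr
      _ = 1 / 2 := by field_simp
  have hr1 : r ≤ 1 := by nlinarith
  have hsub : Metric.ball p₀ r ⊆ Metric.ball p₀ R := Metric.ball_subset_ball hrR
  have hAC : ∀ p ∈ Metric.ball p₀ r, ‖A p‖ ≤ C := fun p hp => by
    have := (hball p (hsub hp)).1.1.1.1
    rw [hC]; linarith [K.coe_nonneg, K'.coe_nonneg]
  have hAC' : ∀ p ∈ Metric.ball p₀ r, ‖fderiv ℝ A p‖ ≤ C := fun p hp => by
    have := (hball p (hsub hp)).1.1.1.2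
    rw [hC]; linarith [K.coe_nonneg, K'.coe_nonneg]
  have hrV : Metric.ball p₀ r ⊆ V := fun p hp => (hball p (hsub hp)).2
  have hd : ∀ p ∈ Metric.ball p₀ r, HasFDerivAt A (fderiv ℝ A p) p := fun p hp =>
    ((hA.contDiffAt (hV.mem_nhds (hrV hp))).differentiableAt (by simp)).hasFDerivAt
  have hlip : ∀ p ∈ Metric.ball p₀ r, ∀ q ∈ Metric.ball p₀ r, ‖A q - A p‖ ≤ C * ‖q - p‖ := by
    intro p hp q hq
    refine (hK'.norm_sub_le (hball q (hsub hq)).1.2 (hball p (hsub hp)).1.2).trans ?_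
    refine mul_le_mul_of_nonneg_right ?_ (norm_nonneg _)
    rw [hC]; linarith [K.coe_nonneg, K'.coe_nonneg]
  have htaylor : ∀ p ∈ Metric.ball p₀ r, ∀ q ∈ Metric.ball p₀ r,
      ‖A q - A p - fderiv ℝ A p (q - p)‖ ≤ C * ‖q - p‖ ^ 2 := by
    intro p hp q hq
    have hseg : segment ℝ p q ⊆ Metric.ball p₀ r := (convex_ball p₀ r).segment_subset hp hq
    rw [pow_two, ← mul_assoc]
    refine (convex_segment p q).norm_image_sub_le_of_norm_hasFDerivWithin_le'
      (fun z hz => (hd z (hseg hz)).hasFDerivWithinAt) (fun z hz => ?_)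
      (left_mem_segment ℝ p q) (right_mem_segment ℝ p q)
    refine (hK.norm_sub_le (hball z (hsub (hseg hz))).1.1.2 (hball p (hsub hp)).1.1.2).trans ?_
    refine mul_le_mul ?_ ?_ (norm_nonneg _) hC0.le
    · rw [hC]; linarith [K.coe_nonneg, K'.coe_nonneg]
    · exact norm_sub_le_of_mem_segment hz
  have hmem : ∀ y : E, ‖y‖ < r → ∀ t ∈ Set.Icc (0 : ℝ) 1, p₀ + t • y ∈ Metric.ball p₀ r := by
    intro y hy t ht
    rw [mem_ball_iff_norm, add_sub_cancel_left, norm_smul, Real.norm_of_nonneg ht.1]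
    exact (mul_le_of_le_one_left (norm_nonneg _) ht.2).trans_lt hy
  refine ⟨r, hr0, hrV, fun w => ?_⟩
  -- The equation is solved along every ray from `p₀`, and `F` is the endpoint at time one. Outside
  -- the ball the constant `w` is a mere default.
  have hsol : ∀ x : E, ∃ γ : ℝ → W, γ 0 = w ∧ (‖x‖ < r → ∀ t ∈ Set.Icc (0 : ℝ) 1,
      HasDerivWithinAt γ (A (p₀ + t • x) x (γ t)) (Set.Icc 0 1) t) := by
    intro x
    by_cases hx : ‖x‖ < r
    · have hc : ContinuousOn (fun t : ℝ => A (p₀ + t • x) x) (Set.Icc 0 1) := by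
        refine ContinuousOn.clm_apply (hA.continuousOn.comp (by fun_prop) fun t ht => ?_)
          continuousOn_const
        exact hrV (hmem x hx t ht)
      obtain ⟨γ, h0, hγ⟩ := exists_linear_ode_solution hc (fun t ht => by
        refine (ContinuousLinearMap.le_of_opNorm_le_of_le _ (hAC _ (hmem x hx t ht)) hx.le).trans
          hCr) w
      exact ⟨γ, h0, fun _ => hγ⟩
    · exact ⟨fun _ => w, rfl, fun h => absurd h hx⟩
  choose γ hγ0 hγ using hsol
  have hγ00 : γ 0 1 = w := by
    have h1 := hγ 0 (by simpa using hr0)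
    have := eq_zero_of_abs_deriv_le_mul_abs_self_of_eq_zero_right (K := 0) (a := 0) (b := 1)
      (f := fun t => γ 0 t - w)
      (fun t ht => ((h1 t ht).sub_const w).continuousWithinAt)
      (fun t ht => ((h1 t ⟨ht.1, ht.2.le⟩).sub_const w).mono_of_mem_nhdsWithin
        (Icc_mem_nhdsGE_of_mem ht)) (by simp [hγ0]) (fun t ht => by simp) 1 (by simp)
    exact sub_eq_zero.1 this
  refine ⟨fun p => γ (p - p₀) 1, by simpa using hγ00, fun p hp => ?_⟩
  obtain ⟨x, rfl⟩ : ∃ x, p = p₀ + x := ⟨p - p₀, by abel⟩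
  have hx : ‖x‖ < r := by simpa [mem_ball_iff_norm] using hp
  have hcont : ContinuousOn (γ x) (Set.Icc 0 1) := fun t ht => (hγ x hx t ht).continuousWithinAt
  obtain ⟨G, hG⟩ := isCompact_Icc.exists_bound_of_continuousOn hcont
  rw [hasFDerivAt_iff_isLittleO_nhds_zero]
  -- With zero initial defect the Grönwall bound is linear in the forcing term, hence quadratic in
  -- `h`, which is stronger than differentiability.
  have hO : (fun h => γ (p₀ + x + h - p₀) 1 - γ (p₀ + x - p₀) 1 -
      (A (p₀ + x)).flip (γ (p₀ + x - p₀) 1) h) =O[𝓝 0] fun h : E => ‖h‖ ^ 2 := by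
    refine Asymptotics.IsBigO.of_bound
      ((2 * C + 2 * C ^ 2) * G / C * (Real.exp (C * 1) - 1)) ?_
    have hev : ∀ᶠ h in 𝓝 (0 : E), ‖x + h‖ < r := by
      have hcts : ContinuousAt (fun h : E => ‖x + h‖) 0 := by fun_prop
      exact hcts.eventually (gt_mem_nhds (by simpa using hx))
    filter_upwards [hev] with h hh
    have hmain := norm_radial_solution_sub_le hr1 hC0.le hd hAC hAC' hlip htaylor
      (fun p hp => hflat p (hrV hp)) hx hh (hγ x hx) (hγ (x + h) hh)
      (by rw [hγ0, hγ0]) hG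
    rw [gronwallBound_of_K_ne_0 hC0.ne'] at hmain
    rw [add_assoc, add_sub_cancel_left, add_sub_cancel_left]
    refine hmain.trans (le_of_eq ?_)
    rw [norm_pow, norm_norm]
    ring
  exact hO.trans_isLittleO (Asymptotics.isLittleO_norm_pow_id one_lt_two)

/-- A differentiable solution of a smooth linear total differential equation is smooth. -/
theorem contDiffOn_of_hasFDerivAt_flip {V : Set E} (hV : IsOpen V)
    {A : E → E →L[ℝ] W →L[ℝ] W} (hA : ContDiffOn ℝ ∞ A V) {F : E → W}
    (hF : ∀ p ∈ V, HasFDerivAt F ((A p).flip (F p)) p) : ContDiffOn ℝ ∞ F V := by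
  refine contDiffOn_infty.2 fun n => ?_
  -- Bootstrapping: the derivative of `F` is an expression in `A` and `F`, so it is as regular as
  -- `F` already is.
  induction n with
  | zero =>
    rw [Nat.cast_zero, contDiffOn_zero]
    exact fun p hp => (hF p hp).continuousAt.continuousWithinAt
  | succ n ih =>
    rw [Nat.cast_succ, contDiffOn_succ_iff_fderiv_of_isOpen hV]
    refine ⟨fun p hp => (hF p hp).differentiableAt.differentiableWithinAt, by simp, ?_⟩
    have h : ContDiffOn ℝ n (fun p => (A p).flip (F p)) V := by
      have h1 : ContDiffOn ℝ n (fun p => (A p).flip) V :=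
        (ContinuousLinearMap.flipₗᵢ ℝ E W W).contDiff.comp_contDiffOn
          (hA.of_le (by norm_cast; exact le_top))
      exact h1.clm_apply ih
    exact h.congr fun p hp => (hF p hp).fderiv

end LinearTotalODE

/-! ### Gluing over a simply connected space -/

section Monodromy

/-- On a simply connected, locally path connected space, sections which are described by local
frames with locally constant transition functions extend globally. -/
theorem exists_section_of_locallyConstant_transition {X : Type*} [TopologicalSpace X]
    [SimplyConnectedSpace X] [LocallyPathConnectedSpace X] {B : X → Type*} {F : Type*}
    (U : X → Set X) (hU : ∀ i, IsOpen (U i)) (hmem : ∀ i, i ∈ U i) (s : X → Π x, F → B x)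
    (hs : ∀ i, ∀ x ∈ U i, Function.Bijective (s i x))
    (hloc : ∀ i j x, x ∈ U i → x ∈ U j → ∀ f g, s i x f = s j x g →
      ∀ᶠ y in 𝓝 x, s i y f = s j y g) (x₀ : X) (b : B x₀) :
    ∃ T : Π x, B x, T x₀ = b ∧ ∀ i x, x ∈ U i → ∃ f, ∀ᶠ y in 𝓝 x, T y = s i y f := by
  classical
  obtain ⟨f₀, hf₀⟩ := (hs x₀ x₀ (hmem x₀)).2 b
  have : Nonempty F := ⟨f₀⟩
  -- With the discrete topology on `F`, locally constant transition functions are continuous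
  -- coordinate changes, and the resulting bundle has discrete fibres.
  let _ : TopologicalSpace F := ⊥
  have : DiscreteTopology F := ⟨rfl⟩
  have hinv : ∀ j x, x ∈ U j → ∀ c, s j x (Function.invFun (s j x) c) = c := fun j x hx c =>
    Function.invFun_eq ((hs j x hx).2 c)
  let Z : FiberBundleCore X X F :=
    { baseSet := U
      isOpen_baseSet := hU
      indexAt := id
      mem_baseSet_at := hmem
      coordChange := fun i j x f => Function.invFun (s j x) (s i x f)
      coordChange_self := fun i x hx v => Function.leftInverse_invFun (hs i x hx).1 v
      continuousOn_coordChange := by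
        rintro i j ⟨x, f⟩ ⟨⟨hxi, hxj⟩, -⟩
        have h := hloc i j x hxi hxj f (Function.invFun (s j x) (s i x f))
          (hinv j x hxj _).symm
        refine ContinuousAt.continuousWithinAt ?_
        have h2 : (fun p : X × F => Function.invFun (s j p.1) (s i p.1 p.2)) =ᶠ[𝓝 (x, f)]
            fun _ => Function.invFun (s j x) (s i x f) := by
          rw [nhds_prod_eq, nhds_discrete F]
          have h3 : ∀ᶠ y in 𝓝 x, y ∈ U j := (hU j).mem_nhds hxj
          have h4 : ∀ᶠ g in pure f, g = f := Filter.eventually_pure.2 rfl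
          filter_upwards [(h.and h3).prod_mk h4]
          rintro ⟨y, g⟩ ⟨⟨hy, hyj⟩, hg⟩
          obtain rfl : g = f := hg
          change Function.invFun (s j y) (s i y g) = _
          rw [hy]
          exact Function.leftInverse_invFun (hs j y hyj).1 _
        exact (continuousAt_const).congr h2.symm
      coordChange_comp := by
        rintro i j k x ⟨⟨hi, hj⟩, hk⟩ v
        exact congrArg _ (hinv j x hj _) }
  -- A section is a lift of the identity through this covering, which exists because `X` is simply
  -- connected.
  have cov : IsCoveringMap (Z.proj) := FiberBundle.isCoveringMap (F := F) (E := Z.Fiber)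
  obtain ⟨G, ⟨hG0, hG⟩, -⟩ := cov.existsUnique_continuousMap_lifts (ContinuousMap.id X) x₀
    (⟨x₀, f₀⟩ : Z.TotalSpace) rfl
  have hG' : ∀ x, (G x).1 = x := fun x => congrFun hG x
  -- The element of `B y` read off from `G y` does not depend on the frame used.
  have key : ∀ i y, y ∈ U i → s y y (Z.localTriv y (G y)).2 = s i y (Z.localTriv i (G y)).2 := by
    intro i y hy
    have := hG' y
    generalize G y = p at this
    subst this
    change s p.1 p.1 (Function.invFun (s p.1 p.1) (s p.1 p.1 p.2)) =
      s i p.1 (Function.invFun (s i p.1) (s p.1 p.1 p.2))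
    rw [hinv _ _ hy, hinv _ _ (hmem _)]
  refine ⟨fun x => s x x (Z.localTriv x (G x)).2, ?_, fun i x hx => ?_⟩
  · beta_reduce
    rw [hG0]
    change s x₀ x₀ (Function.invFun (s x₀ x₀) (s x₀ x₀ f₀)) = b
    rw [hinv _ _ (hmem _), hf₀]
  · have hc : ContinuousAt (fun y => (Z.localTriv i (G y)).2) x := by
      refine continuous_snd.continuousAt.comp ?_
      refine ContinuousAt.comp ?_ G.continuous.continuousAt
      refine (Z.localTriv i).continuousOn.continuousAt ((Z.localTriv i).open_source.mem_nhds ?_)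
      rw [Z.mem_localTriv_source, hG']
      exact hx
    -- A continuous map to a discrete space is locally constant, so in frame `i` the section has
    -- constant coefficient near `x`.
    have hev : ∀ᶠ y in 𝓝 x, (Z.localTriv i (G y)).2 = (Z.localTriv i (G x)).2 := by
      have := hc.tendsto
      rw [nhds_discrete F] at this
      exact this.eventually (p := fun g => g = (Z.localTriv i (G x)).2)
        (Filter.eventually_pure.2 rfl)
    refine ⟨(Z.localTriv i (G x)).2, ?_⟩
    filter_upwards [hev, (hU i).mem_nhds hx] with y hy hyU
    rw [key i y hyU, hy]

end Monodromy

/-! ### Linear algebra in dimension two -/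

section PlaneAlgebra

open Matrix

/-- If the cross product of two vectors vanishes, one is a multiple of the other. -/
theorem exists_eq_mul_of_cross_eq_zero {x y z p q r : ℝ} (h₁ : x * q = y * p) (h₂ : x * r = z * p)
    (h₃ : y * r = z * q) (h : ¬ (p = 0 ∧ q = 0 ∧ r = 0)) :
    ∃ c : ℝ, x = c * p ∧ y = c * q ∧ z = c * r := by
  by_cases hp : p = 0
  · by_cases hq : q = 0
    · have hr : r ≠ 0 := fun hr => h ⟨hp, hq, hr⟩
      refine ⟨z / r, ?_, ?_, by field_simp⟩ <;> field_simp <;> linarith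
    · refine ⟨y / q, ?_, by field_simp, ?_⟩ <;> field_simp <;> linarith
  · refine ⟨x / p, by field_simp, ?_, ?_⟩ <;> field_simp <;> linarith

variable {V : Type*} [AddCommGroup V] [Module ℝ V] (b : Module.Basis (Fin 2) ℝ V)

section BilinearForm

theorem finrank_range_add_finrank_ker_eq_two {V : Type*} [AddCommGroup V] [Module ℝ V]
    (b : Module.Basis (Fin 2) ℝ V) {β : V →ₗ[ℝ] V →ₗ[ℝ] ℝ} :
    Module.finrank ℝ (LinearMap.range β) + Module.finrank ℝ (LinearMap.ker β) = 2 := by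
  have : FiniteDimensional ℝ V := b.finiteDimensional_of_finite
  rw [LinearMap.finrank_range_add_finrank_ker, Module.finrank_eq_card_basis b]
  simp

variable {β : V →ₗ[ℝ] V →ₗ[ℝ] ℝ}

theorem bilin_apply_eq_zero_iff (v : V) : β v = 0 ↔
    b.repr v 0 * β (b 0) (b 0) + b.repr v 1 * β (b 1) (b 0) = 0 ∧
      b.repr v 0 * β (b 0) (b 1) + b.repr v 1 * β (b 1) (b 1) = 0 := by
  have e : ∀ w, β v w = b.repr v 0 * β (b 0) w + b.repr v 1 * β (b 1) w := by
    intro w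
    conv_lhs => rw [← b.sum_repr v]
    simp only [Fin.sum_univ_two, map_add, map_smul, LinearMap.add_apply, LinearMap.smul_apply,
      smul_eq_mul]
  constructor
  · intro h
    rw [← e, ← e, h]
    simp
  · rintro ⟨h0, h1⟩
    refine b.ext fun i => ?_
    fin_cases i
    · simpa [e] using h0
    · simpa [e] using h1

theorem bilin_eq_zero_iff (hβ : ∀ v w, β v w = β w v) : β = 0 ↔
    β (b 0) (b 0) = 0 ∧ β (b 0) (b 1) = 0 ∧ β (b 1) (b 1) = 0 := by
  constructor
  · rintro rfl
    simp
  · rintro ⟨h0, h1, h2⟩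
    refine b.ext fun i => ?_
    rw [LinearMap.zero_apply, bilin_apply_eq_zero_iff b]
    fin_cases i <;> simp [h0, h1, h2, hβ (b 1) (b 0)]

/-- Cramer's rule shows that the kernel is trivial when the Gram determinant is nonzero. -/
theorem finrank_range_bilin_eq_two (hβ : ∀ v w, β v w = β w v)
    (h : β (b 0) (b 0) * β (b 1) (b 1) - β (b 0) (b 1) ^ 2 ≠ 0) :
    Module.finrank ℝ (LinearMap.range β) = 2 := by
  have hker : LinearMap.ker β = ⊥ := by
    rw [LinearMap.ker_eq_bot']
    intro v hv
    obtain ⟨h0, h1⟩ := (bilin_apply_eq_zero_iff b v).1 hv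
    rw [hβ (b 1) (b 0)] at h0
    have e0 : b.repr v 0 = 0 := by
      refine (mul_eq_zero.1 ?_).resolve_right h
      linear_combination β (b 1) (b 1) * h0 - β (b 0) (b 1) * h1
    have e1 : b.repr v 1 = 0 := by
      refine (mul_eq_zero.1 ?_).resolve_right h
      linear_combination β (b 0) (b 0) * h1 - β (b 0) (b 1) * h0
    apply b.repr.injective
    ext i
    fin_cases i <;> simp [e0, e1]
  have := finrank_range_add_finrank_ker_eq_two b (β := β)
  rw [hker, finrank_bot] at this
  exact this

/-- When the Gram determinant vanishes, the columns of the adjugate of the Gram matrix lie in the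
kernel. If the kernel were zero, these columns, and with them the form, would vanish. -/
theorem finrank_range_bilin_eq_one (hβ : ∀ v w, β v w = β w v) (hne : β ≠ 0)
    (h : β (b 0) (b 0) * β (b 1) (b 1) - β (b 0) (b 1) ^ 2 = 0) :
    Module.finrank ℝ (LinearMap.range β) = 1 := by
  have : FiniteDimensional ℝ V := b.finiteDimensional_of_finite
  have hsum := finrank_range_add_finrank_ker_eq_two b (β := β)
  have hrange : Module.finrank ℝ (LinearMap.range β) ≠ 0 := by
    rw [Ne, Submodule.finrank_eq_zero, LinearMap.range_eq_bot]
    exact hne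
  have hmem : ∀ x y : ℝ, x * β (b 0) (b 0) + y * β (b 0) (b 1) = 0 →
      x * β (b 0) (b 1) + y * β (b 1) (b 1) = 0 → x • b 0 + y • b 1 ∈ LinearMap.ker β := by
    intro x y h0 h1
    rw [LinearMap.mem_ker, bilin_apply_eq_zero_iff b, hβ (b 1) (b 0)]
    simpa using ⟨h0, h1⟩
  have hker : Module.finrank ℝ (LinearMap.ker β) ≠ 0 := by
    rw [Ne, Submodule.finrank_eq_zero]
    intro hbot
    have hz : ∀ x y : ℝ, x * β (b 0) (b 0) + y * β (b 0) (b 1) = 0 →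
        x * β (b 0) (b 1) + y * β (b 1) (b 1) = 0 → x = 0 ∧ y = 0 := by
      intro x y h0 h1
      have h2 := hmem x y h0 h1
      rw [hbot, Submodule.mem_bot] at h2
      have h3 := congrArg b.repr h2
      exact ⟨by simpa using DFunLike.congr_fun h3 0, by simpa using DFunLike.congr_fun h3 1⟩
    have h4 := hz (-β (b 0) (b 1)) (β (b 0) (b 0)) (by ring) (by linarith)
    have h5 := hz (β (b 1) (b 1)) (-β (b 0) (b 1)) (by linarith) (by ring)
    exact hne ((bilin_eq_zero_iff b hβ).2 ⟨h4.2, by linarith [h4.1], h5.1⟩)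
  omega

end BilinearForm

/-- A trace free `2 × 2` matrix squares to a multiple of the identity. -/
theorem sq_eq_smul_one_of_trace_eq_zero (m : Matrix (Fin 2) (Fin 2) ℝ) (hm : m.trace = 0) :
    m * m = (m 0 0 ^ 2 + m 0 1 * m 1 0) • (1 : Matrix (Fin 2) (Fin 2) ℝ) := by
  rw [trace_fin_two] at hm
  have h : m 1 1 = - m 0 0 := by linarith
  ext i j
  fin_cases i <;> fin_cases j <;> simp [mul_apply, Fin.sum_univ_two, h] <;> ring

/-- The off-diagonal entries of `m * m` are `tr m` times those of `m`, and its diagonal entries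
differ by `tr m * (m 0 0 - m 1 1)`. This recovers the trace of a parallel extension from its square.
-/
theorem trace_eq_zero_or_eq_smul_one (m : Matrix (Fin 2) (Fin 2) ℝ) {c : ℝ}
    (h : m * m = c • (1 : Matrix (Fin 2) (Fin 2) ℝ)) :
    m.trace = 0 ∨ ∃ s : ℝ, m = s • (1 : Matrix (Fin 2) (Fin 2) ℝ) := by
  rw [trace_fin_two]
  by_cases ht : m 0 0 + m 1 1 = 0
  · exact Or.inl ht
  · right
    have h00 := congrFun (congrFun h 0) 0
    have h01 := congrFun (congrFun h 0) 1
    have h10 := congrFun (congrFun h 1) 0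
    have h11 := congrFun (congrFun h 1) 1
    simp [mul_apply, Fin.sum_univ_two] at h00 h01 h10 h11
    have e01 : m 0 1 = 0 := (mul_eq_zero.1 (by linear_combination h01)).resolve_right ht
    have e10 : m 1 0 = 0 := (mul_eq_zero.1 (by linear_combination h10)).resolve_right ht
    have e11 : m 0 0 - m 1 1 = 0 :=
      (mul_eq_zero.1 (by linear_combination h00 - h11)).resolve_right ht
    refine ⟨m 0 0, ?_⟩
    ext i j
    fin_cases i <;> fin_cases j <;> simp [e01, e10]
    linarith

/-- The trace free part of a commuting matrix is parallel to a trace free matrix. -/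
theorem cross_eq_zero_of_commute {a m : Matrix (Fin 2) (Fin 2) ℝ} (hm : m.trace = 0)
    (h : m * a = a * m) :
    m 0 0 * a 0 1 = m 0 1 * ((a 0 0 - a 1 1) / 2) ∧ m 0 0 * a 1 0 = m 1 0 * ((a 0 0 - a 1 1) / 2) ∧
      m 0 1 * a 1 0 = m 1 0 * a 0 1 := by
  rw [trace_fin_two] at hm
  have e : m 1 1 = - m 0 0 := by linarith
  have h00 := congrFun (congrFun h 0) 0
  have h01 := congrFun (congrFun h 0) 1
  have h10 := congrFun (congrFun h 1) 0
  simp [mul_apply, Fin.sum_univ_two, e] at h00 h01 h10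
  refine ⟨by linarith, by linarith, by linarith⟩

end PlaneAlgebra

/-! ### Components of vector fields and endomorphisms in a chart -/

namespace AffineSurface

noncomputable section Charts

set_option maxSynthPendingDepth 3

variable {M : Type*} [TopologicalSpace M] [ChartedSpace (EuclideanSpace ℝ (Fin 2)) M]

/-- The model space of a surface. -/
abbrev Plane : Type := EuclideanSpace ℝ (Fin 2)

variable {x₀ y : M}

theorem symm_extChartAt (hy : y ∈ (chartAt Plane x₀).source) :
    (extChartAt (𝓡 2) x₀).symm (extChartAt (𝓡 2) x₀ y) = y :=
  (extChartAt (𝓡 2) x₀).left_inv (by rwa [extChartAt_source])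

theorem continuousAt_extChartAt_of_mem (hy : y ∈ (chartAt Plane x₀).source) :
    ContinuousAt (extChartAt (𝓡 2) x₀) y :=
  continuousAt_extChartAt' (by rwa [extChartAt_source])

theorem extChartAt_symm_mem_source {p : Plane} (hp : p ∈ (extChartAt (𝓡 2) x₀).target) :
    (extChartAt (𝓡 2) x₀).symm p ∈ (chartAt Plane x₀).source := by
  rw [← extChartAt_source (𝓡 2)]
  exact (extChartAt (𝓡 2) x₀).map_target hp

theorem extChartAt_mem_target (hy : y ∈ (chartAt Plane x₀).source) :
    extChartAt (𝓡 2) x₀ y ∈ (extChartAt (𝓡 2) x₀).target :=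
  (extChartAt (𝓡 2) x₀).map_source (by rwa [extChartAt_source])

theorem eventually_symm_mem {s : Set M} (hy : y ∈ (chartAt Plane x₀).source) (hs : s ∈ 𝓝 y) :
    ∀ᶠ p in 𝓝 (extChartAt (𝓡 2) x₀ y), (extChartAt (𝓡 2) x₀).symm p ∈ s := by
  have hy' : y ∈ (extChartAt (𝓡 2) x₀).source := by rwa [extChartAt_source]
  have h := continuousAt_extChartAt_symm' hy'
  rw [ContinuousAt, symm_extChartAt hy] at h
  exact h hs

theorem eventually_symm_mem_source (hy : y ∈ (chartAt Plane x₀).source) :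
    ∀ᶠ p in 𝓝 (extChartAt (𝓡 2) x₀ y),
      (extChartAt (𝓡 2) x₀).symm p ∈ (chartAt Plane x₀).source :=
  eventually_symm_mem hy ((chartAt Plane x₀).open_source.mem_nhds hy)

variable [IsManifold (𝓡 2) ∞ M]

/-- The components of a tangent vector at `y` in the chart at `x₀`. -/
def toModel (x₀ y : M) : TangentSpace (𝓡 2) y →L[ℝ] Plane :=
  (trivializationAt Plane (TangentSpace (𝓡 2) : M → Type _) x₀).continuousLinearMapAt ℝ y

/-- The tangent vector at `y` with given components in the chart at `x₀`. -/
def ofModel (x₀ y : M) : Plane →L[ℝ] TangentSpace (𝓡 2) y :=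
  (trivializationAt Plane (TangentSpace (𝓡 2) : M → Type _) x₀).symmL ℝ y

/-- The vector field with constant components in the chart at `x₀`. -/
def constField (x₀ : M) (w : Plane) (y : M) : TangentSpace (𝓡 2) y := ofModel x₀ y w

/-- The components of a vector field in the chart at `x₀`. -/
def vecCoord (x₀ : M) (Z : Π y : M, TangentSpace (𝓡 2) y) (p : Plane) : Plane :=
  toModel x₀ ((extChartAt (𝓡 2) x₀).symm p) (Z ((extChartAt (𝓡 2) x₀).symm p))

/-- The components of a field of endomorphisms in the chart at `x₀`. -/
def endoCoord (x₀ : M) (T : Π y : M, TangentSpace (𝓡 2) y →L[ℝ] TangentSpace (𝓡 2) y)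
    (p : Plane) : Plane →L[ℝ] Plane :=
  toModel x₀ ((extChartAt (𝓡 2) x₀).symm p) ∘L T ((extChartAt (𝓡 2) x₀).symm p) ∘L
    ofModel x₀ ((extChartAt (𝓡 2) x₀).symm p)

theorem toModel_ofModel (hy : y ∈ (chartAt Plane x₀).source) (w : Plane) :
    toModel x₀ y (ofModel x₀ y w) = w :=
  Trivialization.continuousLinearMapAt_symmL _ hy w

theorem ofModel_toModel (hy : y ∈ (chartAt Plane x₀).source) (v : TangentSpace (𝓡 2) y) :
    ofModel x₀ y (toModel x₀ y v) = v :=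
  Trivialization.symmL_continuousLinearMapAt _ hy v

theorem toModel_injective (hy : y ∈ (chartAt Plane x₀).source) :
    Function.Injective (toModel x₀ y) :=
  Function.LeftInverse.injective (ofModel_toModel hy)

/-- Identifies the bundle trivialization with the differential of the chart, which gives access to
the chain rule and to pullbacks of vector fields. -/
theorem toModel_eq_mfderiv (hy : y ∈ (chartAt Plane x₀).source) :
    toModel x₀ y = mfderiv (𝓡 2) 𝓘(ℝ, Plane) (extChartAt (𝓡 2) x₀) y :=
  TangentBundle.continuousLinearMapAt_trivializationAt hy

theorem trivializationAt_snd (hy : y ∈ (chartAt Plane x₀).source) (v : TangentSpace (𝓡 2) y) :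
    (trivializationAt Plane (TangentSpace (𝓡 2) : M → Type _) x₀ ⟨y, v⟩).2 = toModel x₀ y v := by
  rw [toModel, Trivialization.continuousLinearMapAt_apply, Trivialization.coe_linearMapAt_of_mem]
  exact hy

theorem vecCoord_apply (hy : y ∈ (chartAt Plane x₀).source)
    (Z : Π y : M, TangentSpace (𝓡 2) y) :
    vecCoord x₀ Z (extChartAt (𝓡 2) x₀ y) = toModel x₀ y (Z y) := by
  rw [vecCoord, symm_extChartAt hy]

theorem endoCoord_apply (hy : y ∈ (chartAt Plane x₀).source)
    (T : Π y : M, TangentSpace (𝓡 2) y →L[ℝ] TangentSpace (𝓡 2) y) :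
    endoCoord x₀ T (extChartAt (𝓡 2) x₀ y) = toModel x₀ y ∘L T y ∘L ofModel x₀ y := by
  rw [endoCoord, symm_extChartAt hy]

theorem mdifferentiableAt_extChartAt_symm (hy : y ∈ (chartAt Plane x₀).source) :
    MDifferentiableAt 𝓘(ℝ, Plane) (𝓡 2) (extChartAt (𝓡 2) x₀).symm (extChartAt (𝓡 2) x₀ y) :=
  ((contMDiffOn_extChartAt_symm (n := ∞) x₀).contMDiffAt
    ((isOpen_extChartAt_target x₀).mem_nhds (extChartAt_mem_target hy))).mdifferentiableAt (by simp)

theorem contMDiffAt_iff_contDiffAt_comp_symm {F : Type*} [NormedAddCommGroup F] [NormedSpace ℝ F]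
    {f : M → F} (hy : y ∈ (chartAt Plane x₀).source) :
    ContMDiffAt (𝓡 2) 𝓘(ℝ, F) ∞ f y ↔
      ContDiffAt ℝ ∞ (f ∘ (extChartAt (𝓡 2) x₀).symm) (extChartAt (𝓡 2) x₀ y) := by
  rw [contMDiffAt_iff_source_of_mem_source hy, ModelWithCorners.range_eq_univ,
    contMDiffWithinAt_univ, contMDiffAt_iff_contDiffAt]

theorem contDiffAt_iff_of_eventuallyEq {E F : Type*} [NormedAddCommGroup E] [NormedSpace ℝ E]
    [NormedAddCommGroup F] [NormedSpace ℝ F] {f g : E → F} {x : E} {n : ℕ∞ω}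
    (h : f =ᶠ[𝓝 x] g) : ContDiffAt ℝ n f x ↔ ContDiffAt ℝ n g x :=
  ⟨fun hf => hf.congr_of_eventuallyEq h.symm, fun hg => hg.congr_of_eventuallyEq h⟩

theorem contMDiffAt_section_iff (hy : y ∈ (chartAt Plane x₀).source)
    {Z : Π y : M, TangentSpace (𝓡 2) y} :
    ContMDiffAt (𝓡 2) ((𝓡 2).prod 𝓘(ℝ, Plane)) ∞ (fun z => TotalSpace.mk' Plane z (Z z)) y ↔
      ContDiffAt ℝ ∞ (vecCoord x₀ Z) (extChartAt (𝓡 2) x₀ y) := by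
  rw [(trivializationAt Plane (TangentSpace (𝓡 2) : M → Type _) x₀).contMDiffAt_section_iff
    (n := ∞) hy, contMDiffAt_iff_contDiffAt_comp_symm hy]
  refine contDiffAt_iff_of_eventuallyEq ?_
  filter_upwards [eventually_symm_mem_source hy] with p hp
  exact trivializationAt_snd hp _

theorem differentiableAt_vecCoord (hy : y ∈ (chartAt Plane x₀).source)
    {Z : Π y : M, TangentSpace (𝓡 2) y} (hZ : DiffAt Z y) :
    DifferentiableAt ℝ (vecCoord x₀ Z) (extChartAt (𝓡 2) x₀ y) := by
  have h := ((trivializationAt Plane (TangentSpace (𝓡 2) : M → Type _)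
    x₀).mdifferentiableAt_section_iff (𝓡 2) Z hy).1 hZ
  rw [← symm_extChartAt hy] at h
  have h2 := h.comp _ (mdifferentiableAt_extChartAt_symm hy)
  rw [mdifferentiableAt_iff_differentiableAt] at h2
  refine h2.congr_of_eventuallyEq ?_
  filter_upwards [eventually_symm_mem_source hy] with p hp
  exact (trivializationAt_snd hp _).symm

/-- The trivialization of `End(TM)` is conjugation by that of `TM`, which is what `endoCoord`
records; the final `rfl` relies on this. -/
theorem contMDiffAt_endo_iff (hy : y ∈ (chartAt Plane x₀).source)
    {T : Π y : M, TangentSpace (𝓡 2) y →L[ℝ] TangentSpace (𝓡 2) y} :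
    ContMDiffAt (𝓡 2) ((𝓡 2).prod 𝓘(ℝ, Plane →L[ℝ] Plane)) ∞
      (fun z => TotalSpace.mk' (Plane →L[ℝ] Plane)
        (E := fun x : M => TangentSpace (𝓡 2) x →L[ℝ] TangentSpace (𝓡 2) x) z (T z)) y ↔
      ContDiffAt ℝ ∞ (endoCoord x₀ T) (extChartAt (𝓡 2) x₀ y) := by
  rw [(trivializationAt (Plane →L[ℝ] Plane)
    (fun x : M => TangentSpace (𝓡 2) x →L[ℝ] TangentSpace (𝓡 2) x) x₀).contMDiffAt_section_iff
    (n := ∞) (by rw [hom_trivializationAt_baseSet]; exact ⟨hy, hy⟩),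
    contMDiffAt_iff_contDiffAt_comp_symm hy]
  refine contDiffAt_iff_of_eventuallyEq ?_
  filter_upwards [eventually_symm_mem_source hy] with p hp
  rfl

end Charts

end AffineSurface

/-! ### Connection coefficients -/

namespace AffineSurface

noncomputable section ConnectionCoefficients

set_option maxSynthPendingDepth 3

variable {M : Type*} [TopologicalSpace M] [ChartedSpace (EuclideanSpace ℝ (Fin 2)) M]
  [IsManifold (𝓡 2) ∞ M] {x₀ y : M}

/-- The coordinate vector fields of the chart at `x₀`. -/
def coordField (x₀ : M) (i : Fin 2) : Π y : M, TangentSpace (𝓡 2) y :=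
  constField x₀ (EuclideanSpace.basisFun (Fin 2) ℝ i)

/-- The connection coefficients of `D` in the chart at `x₀`. -/
def christoffel (D : AffineConnection M) (x₀ : M) (p : Plane) :
    Plane →L[ℝ] Plane →L[ℝ] Plane :=
  ∑ i : Fin 2, ContinuousLinearMap.smulRightL ℝ Plane Plane (EuclideanSpace.proj i) ∘L
    endoCoord x₀ (fun y => D.cov (coordField x₀ i) y) p

theorem smoothOn_constField (x₀ : M) (w : Plane) :
    SmoothOn (constField x₀ w) (chartAt Plane x₀).source := fun y hy => by
  refine ContMDiffAt.contMDiffWithinAt ((contMDiffAt_section_iff hy).2 ?_)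
  refine (contDiffAt_const (c := w)).congr_of_eventuallyEq ?_
  filter_upwards [eventually_symm_mem_source hy] with p hp
  exact toModel_ofModel hp w

theorem diffAt_of_smoothOn {Z : Π y : M, TangentSpace (𝓡 2) y} {s : Set M} (hs : IsOpen s)
    (hZ : SmoothOn Z s) (hy : y ∈ s) : DiffAt Z y :=
  (hZ.contMDiffAt (hs.mem_nhds hy)).mdifferentiableAt (by simp)

theorem diffAt_constField (hy : y ∈ (chartAt Plane x₀).source) (w : Plane) :
    DiffAt (constField x₀ w) y :=
  diffAt_of_smoothOn (chartAt Plane x₀).open_source (smoothOn_constField x₀ w) hy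

theorem vecCoord_constField (hy : y ∈ (chartAt Plane x₀).source) (w : Plane) :
    vecCoord x₀ (constField x₀ w) =ᶠ[𝓝 (extChartAt (𝓡 2) x₀ y)] fun _ => w := by
  filter_upwards [eventually_symm_mem_source hy] with p hp
  exact toModel_ofModel hp w

theorem cov_congr (D : AffineConnection M) {Z W : Π y : M, TangentSpace (𝓡 2) y}
    (hZ : DiffAt Z y) (h : ∀ᶠ z in 𝓝 y, Z z = W z) : D.cov Z y = D.cov W y := by
  refine D.cov.isCovariantDerivativeOnUniv.congr_of_eventuallyEq hZ ?_ Filter.univ_mem h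
  refine hZ.congr_of_eventuallyEq ?_
  filter_upwards [h] with z hz
  rw [hz]

theorem christoffel_apply (D : AffineConnection M) (hy : y ∈ (chartAt Plane x₀).source)
    (v w : Plane) : christoffel D x₀ (extChartAt (𝓡 2) x₀ y) v w =
      ∑ i : Fin 2, w i • toModel x₀ y (D.cov (coordField x₀ i) y (ofModel x₀ y v)) := by
  simp only [christoffel, endoCoord_apply hy]
  simp

/-- The covariant derivative in a chart. -/
theorem toModel_cov (D : AffineConnection M) (hy : y ∈ (chartAt Plane x₀).source)
    {Z : Π y : M, TangentSpace (𝓡 2) y} (hZ : DiffAt Z y) (v : Plane) :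
    toModel x₀ y (D.cov Z y (ofModel x₀ y v)) =
      fderiv ℝ (vecCoord x₀ Z) (extChartAt (𝓡 2) x₀ y) v +
        christoffel D x₀ (extChartAt (𝓡 2) x₀ y) v (toModel x₀ y (Z y)) := by
  -- Near `y` the field `Z` is `f 0` and `f 1` times the coordinate fields. The Leibniz rule then
  -- splits `∇Z` into the derivative of the components and the Christoffel term.
  let f : Fin 2 → M → ℝ := fun i z => toModel x₀ z (Z z) i
  have hd := differentiableAt_vecCoord hy hZ
  have hφ : HasMFDerivAt (𝓡 2) 𝓘(ℝ, Plane) (extChartAt (𝓡 2) x₀) y (toModel x₀ y) := by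
    rw [toModel_eq_mfderiv hy]
    exact (mdifferentiableAt_extChartAt hy).hasMFDerivAt
  have hf : ∀ i, HasMFDerivAt (𝓡 2) 𝓘(ℝ, ℝ) (f i) y
      (((EuclideanSpace.proj i : Plane →L[ℝ] ℝ) ∘L
        fderiv ℝ (vecCoord x₀ Z) (extChartAt (𝓡 2) x₀ y)) ∘L toModel x₀ y) := by
    intro i
    have h1 : HasFDerivAt (fun p => vecCoord x₀ Z p i) ((EuclideanSpace.proj i : Plane →L[ℝ] ℝ) ∘L
        fderiv ℝ (vecCoord x₀ Z) (extChartAt (𝓡 2) x₀ y)) (extChartAt (𝓡 2) x₀ y) :=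
      (EuclideanSpace.proj i : Plane →L[ℝ] ℝ).hasFDerivAt.comp _ hd.hasFDerivAt
    refine (h1.hasMFDerivAt.comp y hφ).congr_of_eventuallyEq ?_
    filter_upwards [(chartAt Plane x₀).open_source.mem_nhds hy] with z hz
    change _ = vecCoord x₀ Z (extChartAt (𝓡 2) x₀ z) i
    rw [vecCoord_apply hz]
  have hsec : ∀ i, DiffAt (coordField x₀ i) y := fun i => diffAt_constField hy _
  have hleib := fun i => D.cov.isCovariantDerivativeOnUniv.leibniz (hsec i)
    (hf i).mdifferentiableAt
  have hfs : ∀ i, DiffAt (f i • coordField x₀ i) y := fun i =>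
    (hf i).mdifferentiableAt.smul_section (hsec i)
  have hsum : D.cov Z y = D.cov (f 0 • coordField x₀ 0 + f 1 • coordField x₀ 1) y := by
    refine cov_congr D hZ ?_
    filter_upwards [(chartAt Plane x₀).open_source.mem_nhds hy] with z hz
    apply toModel_injective hz
    simp only [Pi.add_apply, Pi.smul_apply', map_add, map_smul, coordField, constField,
      toModel_ofModel hz]
    ext i
    fin_cases i <;> simp [f]
  have hmv : ∀ i, mvfderiv (𝓡 2) (f i) y (ofModel x₀ y v) =
      fderiv ℝ (vecCoord x₀ Z) (extChartAt (𝓡 2) x₀ y) v i := by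
    intro i
    simp only [mvfderiv, (hf i).mfderiv]
    change fderiv ℝ (vecCoord x₀ Z) (extChartAt (𝓡 2) x₀ y) (toModel x₀ y (ofModel x₀ y v)) i = _
    rw [toModel_ofModel hy]
  rw [hsum, D.cov.isCovariantDerivativeOnUniv.add (hfs 0) (hfs 1), hleib, hleib,
    christoffel_apply D hy]
  simp only [add_apply, smul_apply, ContinuousLinearMap.smulRight_apply, hmv, map_add, map_smul,
    Fin.sum_univ_two]
  have e : ∀ i, toModel x₀ y (coordField x₀ i y) = EuclideanSpace.basisFun (Fin 2) ℝ i :=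
    fun i => toModel_ofModel hy _
  rw [e, e]
  have e2 : ∀ u : Plane, u = u 0 • EuclideanSpace.basisFun (Fin 2) ℝ 0 +
      u 1 • EuclideanSpace.basisFun (Fin 2) ℝ 1 := fun u => by
    ext i
    fin_cases i <;> simp
  conv_rhs => rw [e2 (fderiv ℝ (vecCoord x₀ Z) (extChartAt (𝓡 2) x₀ y) v)]
  simp only [f]
  abel

/-- Smoothness of `D` is invoked for a globally smooth section, so `Z` is cut off by a bump
function; near `x` the cut-off changes neither `Z` nor its covariant derivative. -/
theorem smoothOn_cov [T2Space M] (D : AffineConnection M) {Z X : Π y : M, TangentSpace (𝓡 2) y}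
    {s : Set M} (hs : IsOpen s) (hZ : SmoothOn Z s) (hX : SmoothOn X s) :
    SmoothOn (fun y => D.cov Z y (X y)) s := by
  intro x hx
  obtain ⟨f, hfs⟩ : ∃ f : SmoothBumpFunction (𝓡 2) x, tsupport f ⊆ s := by
    obtain ⟨f, -, hfs⟩ :=
      (SmoothBumpFunction.nhds_basis_tsupport (I := 𝓡 2) x).mem_iff.1 (hs.mem_nhds hx)
    exact ⟨f, hfs⟩
  have hW : SmoothOn ((f : M → ℝ) • Z) Set.univ :=
    (ContMDiffOn.smul_section_of_tsupport f.contMDiff.contMDiffOn hs hfs hZ).contMDiffOn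
  have h1 := D.smooth.contMDiff.contMDiff (σ := (f : M → ℝ) • Z) hW
  have h2 := (h1.contMDiffAt (x := x) Filter.univ_mem)
  have h3 := h2.clm_bundle_apply (hX.contMDiffAt (hs.mem_nhds hx))
  refine (h3.congr_of_eventuallyEq ?_).contMDiffWithinAt
  filter_upwards [eventually_eventually_nhds.2 f.eventuallyEq_one, hs.mem_nhds hx] with y hy hys
  congr 2
  refine cov_congr D (diffAt_of_smoothOn hs hZ hys) ?_
  filter_upwards [hy] with z hz
  simp [hz]

/-- In finite dimension an operator-valued map is smooth once its values on each fixed vector are;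
here these are components of covariant derivatives of coordinate fields along constant fields. -/
theorem contDiffOn_christoffel [T2Space M] (D : AffineConnection M) (x₀ : M) :
    ContDiffOn ℝ ∞ (christoffel D x₀) (extChartAt (𝓡 2) x₀).target := by
  refine ContDiffOn.sum fun i _ => ?_
  refine ContDiffOn.clm_comp contDiffOn_const ?_
  rw [contDiffOn_clm_apply]
  intro v p hp
  have hsrc := extChartAt_symm_mem_source hp
  have h := (smoothOn_cov D (chartAt Plane x₀).open_source
    (smoothOn_constField x₀ (EuclideanSpace.basisFun (Fin 2) ℝ i))
    (smoothOn_constField x₀ v)).contMDiffAt ((chartAt Plane x₀).open_source.mem_nhds hsrc)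
  have h2 := (contMDiffAt_section_iff hsrc).1 h
  rw [(extChartAt (𝓡 2) x₀).right_inv hp] at h2
  exact h2.contDiffWithinAt

end ConnectionCoefficients

end AffineSurface

/-! ### Curvature in a chart -/

namespace AffineSurface

noncomputable section CurvatureInCharts

set_option maxSynthPendingDepth 3

variable {M : Type*} [TopologicalSpace M] [ChartedSpace (EuclideanSpace ℝ (Fin 2)) M]
  [IsManifold (𝓡 2) ∞ M] {x₀ y : M}

/-- The curvature form of the connection coefficients in the chart at `x₀`. -/
def curvatureForm (D : AffineConnection M) (x₀ : M) (p u v : Plane) : Plane →L[ℝ] Plane :=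
  fderiv ℝ (christoffel D x₀) p u v - fderiv ℝ (christoffel D x₀) p v u +
    (christoffel D x₀ p u ∘L christoffel D x₀ p v - christoffel D x₀ p v ∘L christoffel D x₀ p u)

/-- The constant vector field on the model space. -/
def modelConst (w : Plane) (p : Plane) : TangentSpace 𝓘(ℝ, Plane) p := w

theorem mlieBracket_modelConst (u v : Plane) :
    mlieBracket 𝓘(ℝ, Plane) (modelConst u) (modelConst v) = 0 := by
  rw [← mlieBracketWithin_univ, mlieBracketWithin_eq_lieBracketWithin]
  change lieBracketWithin ℝ (fun _ : Plane => u) (fun _ : Plane => v) Set.univ = 0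
  ext1 p
  simp [lieBracketWithin_eq]

theorem constField_eq_mpullback (hy : y ∈ (chartAt Plane x₀).source) (w : Plane) :
    constField x₀ w =ᶠ[𝓝 y]
      mpullback (𝓡 2) 𝓘(ℝ, Plane) (extChartAt (𝓡 2) x₀) (modelConst w) := by
  filter_upwards [(chartAt Plane x₀).open_source.mem_nhds hy] with z hz
  have hinv : (mfderiv (𝓡 2) 𝓘(ℝ, Plane) (extChartAt (𝓡 2) x₀) z).IsInvertible :=
    isInvertible_mfderiv_extChartAt (by rwa [extChartAt_source])
  have h : toModel x₀ z (mpullback (𝓡 2) 𝓘(ℝ, Plane) (extChartAt (𝓡 2) x₀) (modelConst w) z)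
      = w := by
    rw [toModel_eq_mfderiv hz]
    exact hinv.self_apply_inverse _
  apply toModel_injective hz
  rw [h, constField, toModel_ofModel hz]

/-- Constant fields are chart pullbacks of constant fields on the plane, which commute, and the
bracket is natural under pullback. This removes the bracket term from the curvature. -/
theorem mlieBracket_constField (hy : y ∈ (chartAt Plane x₀).source) (u v : Plane) :
    mlieBracket (𝓡 2) (constField x₀ u) (constField x₀ v) y = 0 := by
  have hman : IsManifold (𝓡 2) (minSmoothness ℝ 2) M :=
    IsManifold.of_le (n := ∞) (by simp; norm_cast)
  have hd : ∀ w : Plane, MDifferentiableAt 𝓘(ℝ, Plane) (𝓘(ℝ, Plane).prod 𝓘(ℝ, Plane))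
      (fun p => TotalSpace.mk' Plane p (modelConst w p)) (extChartAt (𝓡 2) x₀ y) := fun w =>
    (contMDiffAt_vectorSpace_iff_contDiffAt.2
      (contDiffAt_const (n := 1) (c := w))).mdifferentiableAt one_ne_zero
  rw [(constField_eq_mpullback hy u).mlieBracket_vectorField_eq (constField_eq_mpullback hy v),
    ← mpullback_mlieBracket (n := ∞) (hd u) (hd v) (contMDiffAt_extChartAt' hy)
    (by simp; norm_cast), mlieBracket_modelConst, mpullback_zero]
  rfl

/-- The curvature operator on the coordinate fields, in a chart. -/
theorem toModel_curvatureAux [T2Space M] (D : AffineConnection M)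
    (hy : y ∈ (chartAt Plane x₀).source) {s : Set M} (hs : IsOpen s) (hys : y ∈ s)
    {Z : Π y : M, TangentSpace (𝓡 2) y} (hZ : SmoothOn Z s) (u v : Plane) :
    toModel x₀ y (curvatureAux D (constField x₀ u) (constField x₀ v) Z y) =
      curvatureForm D x₀ (extChartAt (𝓡 2) x₀ y) u v (toModel x₀ y (Z y)) := by
  set p₀ := extChartAt (𝓡 2) x₀ y with hp₀
  have hZat : ContDiffAt ℝ ∞ (vecCoord x₀ Z) p₀ :=
    (contMDiffAt_section_iff hy).1 (hZ.contMDiffAt (hs.mem_nhds hys))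
  have hZ' : DifferentiableAt ℝ (vecCoord x₀ Z) p₀ := hZat.differentiableAt (by simp)
  have hZ'' : DifferentiableAt ℝ (fderiv ℝ (vecCoord x₀ Z)) p₀ :=
    (hZat.fderiv_right (m := 1) (by norm_cast)).differentiableAt (by simp)
  have hΓ : DifferentiableAt ℝ (christoffel D x₀) p₀ :=
    ((contDiffOn_christoffel D x₀).contDiffAt
      ((isOpen_extChartAt_target x₀).mem_nhds (extChartAt_mem_target hy))).differentiableAt
      (by simp)
  have hvc : ∀ v : Plane, vecCoord x₀ (fun z => D.cov Z z (constField x₀ v z)) =ᶠ[𝓝 p₀]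
      fun p => fderiv ℝ (vecCoord x₀ Z) p v + christoffel D x₀ p v (vecCoord x₀ Z p) := by
    intro v
    filter_upwards [eventually_symm_mem_source hy, eventually_symm_mem hy (hs.mem_nhds hys),
      (isOpen_extChartAt_target x₀).mem_nhds (extChartAt_mem_target hy)] with p hp hps hpt
    have h := toModel_cov D hp (diffAt_of_smoothOn hs hZ hps) v
    rw [(extChartAt (𝓡 2) x₀).right_inv hpt] at h
    exact h
  have hcov : ∀ u v : Plane, toModel x₀ y
      (D.cov (fun z => D.cov Z z (constField x₀ v z)) y (constField x₀ u y)) =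
      fderiv ℝ (fderiv ℝ (vecCoord x₀ Z)) p₀ u v +
        (fderiv ℝ (christoffel D x₀) p₀ u v (vecCoord x₀ Z p₀) +
          christoffel D x₀ p₀ v (fderiv ℝ (vecCoord x₀ Z) p₀ u)) +
        christoffel D x₀ p₀ u (fderiv ℝ (vecCoord x₀ Z) p₀ v +
          christoffel D x₀ p₀ v (vecCoord x₀ Z p₀)) := by
    intro u v
    have h1 : DiffAt (fun z => D.cov Z z (constField x₀ v z)) y :=
      mdifferentiableAt_cov D hs hys hZ (diffAt_constField hy v)
    have h2 := toModel_cov D hy h1 u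
    rw [← vecCoord_apply hy (fun z => D.cov Z z (constField x₀ v z)), (hvc v).fderiv_eq,
      (hvc v).eq_of_nhds] at h2
    rw [constField, h2]
    have hd : HasFDerivAt (fun p => fderiv ℝ (vecCoord x₀ Z) p v +
        christoffel D x₀ p v (vecCoord x₀ Z p)) _ p₀ :=
      (hZ''.hasFDerivAt.clm_apply (hasFDerivAt_const v p₀)).add
        ((hΓ.hasFDerivAt.clm_apply (hasFDerivAt_const v p₀)).clm_apply hZ'.hasFDerivAt)
    rw [hd.fderiv]
    simp
    abel
  -- Equality of mixed partials cancels the second derivatives of `Z`; the first-order terms cancel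
  -- by antisymmetry in `u` and `v`, leaving an algebraic operator.
  have hsymm : fderiv ℝ (fderiv ℝ (vecCoord x₀ Z)) p₀ u v =
      fderiv ℝ (fderiv ℝ (vecCoord x₀ Z)) p₀ v u :=
    (hZat.isSymmSndFDerivAt (by simp; norm_cast)) u v
  rw [curvatureAux, mlieBracket_constField hy, map_zero, sub_zero, map_sub, hcov, hcov, hsymm,
    ← vecCoord_apply hy Z, ← hp₀, curvatureForm]
  simp
  abel

/-- The curvature tensor in a chart. -/
theorem toModel_curvature [T2Space M] (D : AffineConnection M)
    (hy : y ∈ (chartAt Plane x₀).source) (u v : Plane) (w : TangentSpace (𝓡 2) y) :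
    toModel x₀ y (curvature D w (ofModel x₀ y u) (ofModel x₀ y v)) =
      curvatureForm D x₀ (extChartAt (𝓡 2) x₀ y) u v (toModel x₀ y w) := by
  obtain ⟨s, hs, hys, hw⟩ := exists_smooth_extendConst w
  have h := curvature_apply D w (diffAt_constField hy u) (diffAt_constField hy v)
  rw [constField, constField] at h
  rw [h, toModel_curvatureAux D hy hs hys hw, extendConst_self]

/-- The curvature tensor can be computed with any smooth extension of the third argument. -/
theorem curvature_eq_curvatureAux [T2Space M] (D : AffineConnection M) {s : Set M} (hs : IsOpen s)
    (hys : y ∈ s) {Z : Π y : M, TangentSpace (𝓡 2) y} (hZ : SmoothOn Z s) (u v : Plane) :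
    curvature D (Z y) (ofModel y y u) (ofModel y y v) =
      curvatureAux D (constField y u) (constField y v) Z y := by
  have hy : y ∈ (chartAt Plane y).source := mem_chart_source _ _
  apply toModel_injective hy
  rw [toModel_curvature D hy, toModel_curvatureAux D hy hs hys hZ]

end CurvatureInCharts

end AffineSurface

/-! ### Parallel endomorphism fields: equation and uniqueness -/

namespace AffineSurface

noncomputable section ParallelTensors

set_option maxSynthPendingDepth 3

variable {M : Type*} [TopologicalSpace M] [ChartedSpace (EuclideanSpace ℝ (Fin 2)) M]
  [IsManifold (𝓡 2) ∞ M] {x₀ y : M}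

/-- The field of endomorphisms `T` is smooth and parallel at `y`. -/
def IsParallelAt (D : AffineConnection M)
    (T : Π y : M, TangentSpace (𝓡 2) y →L[ℝ] TangentSpace (𝓡 2) y) (y : M) : Prop :=
  ContMDiffAt (𝓡 2) ((𝓡 2).prod 𝓘(ℝ, Plane →L[ℝ] Plane)) ∞
      (fun z => TotalSpace.mk' (Plane →L[ℝ] Plane)
        (E := fun x : M => TangentSpace (𝓡 2) x →L[ℝ] TangentSpace (𝓡 2) x) z (T z)) y ∧
    ∀ X : Π x : M, TangentSpace (𝓡 2) x, DiffAt X y → ∀ v : TangentSpace (𝓡 2) y,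
      D.cov (fun z => T z (X z)) y v = T y (D.cov X y v)

/-- The map `G ↦ (S ↦ S G - G S)`. -/
def commutatorCLM : (Plane →L[ℝ] Plane) →L[ℝ] (Plane →L[ℝ] Plane) →L[ℝ] (Plane →L[ℝ] Plane) :=
  (ContinuousLinearMap.compL ℝ Plane Plane Plane).flip -
    ContinuousLinearMap.compL ℝ Plane Plane Plane

theorem commutatorCLM_apply (G S : Plane →L[ℝ] Plane) : commutatorCLM G S = S * G - G * S := rfl

/-- The coefficients of the total differential equation satisfied by parallel fields of
endomorphisms in the chart at `x₀`. -/
def parallelForm (D : AffineConnection M) (x₀ : M) (p : Plane) :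
    Plane →L[ℝ] (Plane →L[ℝ] Plane) →L[ℝ] (Plane →L[ℝ] Plane) :=
  commutatorCLM ∘L christoffel D x₀ p

theorem parallelForm_apply (D : AffineConnection M) (x₀ : M) (p v w : Plane)
    (S : Plane →L[ℝ] Plane) : parallelForm D x₀ p v S w =
      S (christoffel D x₀ p v w) - christoffel D x₀ p v (S w) := rfl

theorem endoCoord_apply_apply (x₀ : M)
    (T : Π y : M, TangentSpace (𝓡 2) y →L[ℝ] TangentSpace (𝓡 2) y) (p w : Plane) :
    endoCoord x₀ T p w = toModel x₀ ((extChartAt (𝓡 2) x₀).symm p)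
      (T ((extChartAt (𝓡 2) x₀).symm p) (ofModel x₀ ((extChartAt (𝓡 2) x₀).symm p) w)) := rfl

theorem contDiffOn_parallelForm [T2Space M] (D : AffineConnection M) (x₀ : M) :
    ContDiffOn ℝ ∞ (parallelForm D x₀) (extChartAt (𝓡 2) x₀).target :=
  contDiffOn_const.clm_comp (contDiffOn_christoffel D x₀)

theorem diffAt_endo_apply {T : Π y : M, TangentSpace (𝓡 2) y →L[ℝ] TangentSpace (𝓡 2) y}
    (hT : ContMDiffAt (𝓡 2) ((𝓡 2).prod 𝓘(ℝ, Plane →L[ℝ] Plane)) ∞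
      (fun z => TotalSpace.mk' (Plane →L[ℝ] Plane)
        (E := fun x : M => TangentSpace (𝓡 2) x →L[ℝ] TangentSpace (𝓡 2) x) z (T z)) y)
    {X : Π x : M, TangentSpace (𝓡 2) x} (hX : DiffAt X y) : DiffAt (fun z => T z (X z)) y :=
  (hT.mdifferentiableAt (by simp)).clm_bundle_apply hX

theorem vecCoord_endo_apply (hy : y ∈ (chartAt Plane x₀).source)
    (T : Π y : M, TangentSpace (𝓡 2) y →L[ℝ] TangentSpace (𝓡 2) y)
    (X : Π x : M, TangentSpace (𝓡 2) x) :
    vecCoord x₀ (fun z => T z (X z)) =ᶠ[𝓝 (extChartAt (𝓡 2) x₀ y)]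
      fun p => endoCoord x₀ T p (vecCoord x₀ X p) := by
  filter_upwards [eventually_symm_mem_source hy] with p hp
  simp only [vecCoord, endoCoord, ContinuousLinearMap.comp_apply, ofModel_toModel hp]

/-- Testing `∇T = 0` on fields with constant components gives `dT = TΓ - ΓT`; conversely, the
product rule for `T X` in components recovers the condition for every differentiable `X`. -/
theorem isParallelAt_iff (D : AffineConnection M) (hy : y ∈ (chartAt Plane x₀).source)
    {T : Π y : M, TangentSpace (𝓡 2) y →L[ℝ] TangentSpace (𝓡 2) y} :
    IsParallelAt D T y ↔ ContDiffAt ℝ ∞ (endoCoord x₀ T) (extChartAt (𝓡 2) x₀ y) ∧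
      HasFDerivAt (endoCoord x₀ T) ((parallelForm D x₀ (extChartAt (𝓡 2) x₀ y)).flip
        (endoCoord x₀ T (extChartAt (𝓡 2) x₀ y))) (extChartAt (𝓡 2) x₀ y) := by
  rw [IsParallelAt, contMDiffAt_endo_iff hy]
  refine and_congr_right fun hs => ?_
  have hs' := (contMDiffAt_endo_iff hy).2 hs
  have hd := hs.differentiableAt (by simp)
  have key : ∀ X : Π x : M, TangentSpace (𝓡 2) x, DiffAt X y → ∀ v : Plane,
      toModel x₀ y (D.cov (fun z => T z (X z)) y (ofModel x₀ y v)) =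
        fderiv ℝ (endoCoord x₀ T) (extChartAt (𝓡 2) x₀ y) v (toModel x₀ y (X y)) +
        endoCoord x₀ T (extChartAt (𝓡 2) x₀ y)
          (fderiv ℝ (vecCoord x₀ X) (extChartAt (𝓡 2) x₀ y) v) +
        christoffel D x₀ (extChartAt (𝓡 2) x₀ y) v
          (endoCoord x₀ T (extChartAt (𝓡 2) x₀ y) (toModel x₀ y (X y))) := by
    intro X hX v
    have e := vecCoord_endo_apply hy T X
    have h1 := hd.hasFDerivAt.clm_apply (differentiableAt_vecCoord hy hX).hasFDerivAt
    rw [toModel_cov D hy (diffAt_endo_apply hs' hX), e.fderiv_eq, h1.fderiv,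
      ← vecCoord_apply hy (fun z => T z (X z)), e.eq_of_nhds, vecCoord_apply hy]
    simp
    abel
  constructor
  · intro h
    have : fderiv ℝ (endoCoord x₀ T) (extChartAt (𝓡 2) x₀ y) =
        (parallelForm D x₀ (extChartAt (𝓡 2) x₀ y)).flip
          (endoCoord x₀ T (extChartAt (𝓡 2) x₀ y)) := by
      ext1 v
      ext1 w
      have h1 := key _ (diffAt_constField hy w) v
      rw [h _ (diffAt_constField hy w)] at h1
      have h2 := toModel_cov D hy (diffAt_constField hy w) v
      rw [(vecCoord_constField hy w).fderiv_eq, constField, toModel_ofModel hy] at h2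
      rw [(vecCoord_constField hy w).fderiv_eq, constField, toModel_ofModel hy,
        ← ofModel_toModel hy (D.cov (constField x₀ w) y (ofModel x₀ y v)), h2] at h1
      have h3 : toModel x₀ y (T y (ofModel x₀ y
          (christoffel D x₀ (extChartAt (𝓡 2) x₀ y) v w))) =
          endoCoord x₀ T (extChartAt (𝓡 2) x₀ y)
            (christoffel D x₀ (extChartAt (𝓡 2) x₀ y) v w) := by
        rw [endoCoord_apply hy]
        rfl
      simp only [fderiv_fun_const, Pi.zero_apply, zero_apply, zero_add, map_zero, add_zero] at h1
      rw [h3] at h1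
      rw [eq_sub_of_add_eq h1.symm]
      rfl
    rw [← this]
    exact hd.hasFDerivAt
  · intro h X hX v
    apply toModel_injective hy
    have h1 := key X hX (toModel x₀ y v)
    have h2 := toModel_cov D hy hX (toModel x₀ y v)
    rw [ofModel_toModel hy] at h1 h2
    have h3 : toModel x₀ y (T y (D.cov X y v)) =
        endoCoord x₀ T (extChartAt (𝓡 2) x₀ y) (toModel x₀ y (D.cov X y v)) := by
      rw [endoCoord_apply hy]
      simp only [ContinuousLinearMap.comp_apply, ofModel_toModel hy]
    rw [h1, h3, h2, h.fderiv]
    simp only [ContinuousLinearMap.flip_apply, parallelForm_apply, map_add]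
    abel

theorem IsParallelAt.congr {D : AffineConnection M}
    {S T : Π y : M, TangentSpace (𝓡 2) y →L[ℝ] TangentSpace (𝓡 2) y} (hS : IsParallelAt D S y)
    (h : ∀ᶠ z in 𝓝 y, S z = T z) : IsParallelAt D T y := by
  have hy : y ∈ (chartAt Plane y).source := mem_chart_source _ _
  rw [isParallelAt_iff D hy] at hS ⊢
  have e : endoCoord y T =ᶠ[𝓝 (extChartAt (𝓡 2) y y)] endoCoord y S := by
    filter_upwards [eventually_symm_mem hy h] with p hp
    have hp' : S ((extChartAt (𝓡 2) y).symm p) = T ((extChartAt (𝓡 2) y).symm p) := hp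
    rw [endoCoord, endoCoord, hp']
  rw [e.eq_of_nhds]
  exact ⟨hS.1.congr_of_eventuallyEq e, hS.2.congr_of_eventuallyEq e⟩

theorem IsParallelAt.sub {D : AffineConnection M}
    {S T : Π y : M, TangentSpace (𝓡 2) y →L[ℝ] TangentSpace (𝓡 2) y} (hS : IsParallelAt D S y)
    (hT : IsParallelAt D T y) : IsParallelAt D (fun z => S z - T z) y := by
  have hy : y ∈ (chartAt Plane y).source := mem_chart_source _ _
  rw [isParallelAt_iff D hy] at hS hT ⊢
  have e : endoCoord y (fun z => S z - T z) = fun p => endoCoord y S p - endoCoord y T p := by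
    funext p
    ext1 w
    simp only [endoCoord_apply_apply, sub_apply, map_sub]
  rw [e]
  refine ⟨hS.1.sub hT.1, ?_⟩
  rw [map_sub]
  exact hS.2.sub hT.2

theorem IsParallelAt.comp {D : AffineConnection M}
    {S T : Π y : M, TangentSpace (𝓡 2) y →L[ℝ] TangentSpace (𝓡 2) y} (hS : IsParallelAt D S y)
    (hT : IsParallelAt D T y) : IsParallelAt D (fun z => S z ∘L T z) y := by
  have hy : y ∈ (chartAt Plane y).source := mem_chart_source _ _
  refine ⟨(contMDiffAt_endo_iff hy).2 ?_, fun X hX v => ?_⟩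
  · have e : endoCoord y (fun z => S z ∘L T z) =ᶠ[𝓝 (extChartAt (𝓡 2) y y)]
        fun p => endoCoord y S p ∘L endoCoord y T p := by
      filter_upwards [eventually_symm_mem_source hy] with p hp
      ext1 w
      simp only [endoCoord, ContinuousLinearMap.comp_apply, ofModel_toModel hp]
    exact (((contMDiffAt_endo_iff hy).1 hS.1).clm_comp
      ((contMDiffAt_endo_iff hy).1 hT.1)).congr_of_eventuallyEq e
  · have h1 := hS.2 _ (diffAt_endo_apply hT.1 hX) v
    rw [hT.2 X hX v] at h1
    exact h1

theorem isParallelAt_smul_id (D : AffineConnection M) (c : ℝ) (y : M) :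
    IsParallelAt D (fun z => c • ContinuousLinearMap.id ℝ (TangentSpace (𝓡 2) z)) y := by
  have hy : y ∈ (chartAt Plane y).source := mem_chart_source _ _
  refine ⟨(contMDiffAt_endo_iff hy).2 ?_, fun X hX v => ?_⟩
  · refine (contDiffAt_const (c := c • ContinuousLinearMap.id ℝ Plane)).congr_of_eventuallyEq ?_
    filter_upwards [eventually_symm_mem_source hy] with p hp
    ext1 w
    rw [endoCoord_apply_apply, smul_apply, map_smul]
    exact congrArg (c • ·) (toModel_ofModel hp w)
  · exact congrArg (fun L => L v) (D.cov.isCovariantDerivativeOnUniv.smul_const c hX)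

theorem endo_eq_zero_iff (hy : y ∈ (chartAt Plane x₀).source)
    (T : Π y : M, TangentSpace (𝓡 2) y →L[ℝ] TangentSpace (𝓡 2) y) :
    T y = 0 ↔ endoCoord x₀ T (extChartAt (𝓡 2) x₀ y) = 0 := by
  rw [endoCoord_apply hy]
  constructor
  · intro h
    simp [h]
  · intro h
    ext1 v
    apply toModel_injective hy
    have := congrArg (fun L : Plane →L[ℝ] Plane => L (toModel x₀ y v)) h
    simpa [ofModel_toModel hy] using this

/-- Local uniqueness of parallel fields of endomorphisms. -/
theorem exists_nhds_forall_eq_zero [T2Space M] (D : AffineConnection M) {s : Set M}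
    (hs : s ∈ 𝓝 y) : ∃ N ∈ 𝓝 y,
      ∀ T : Π y : M, TangentSpace (𝓡 2) y →L[ℝ] TangentSpace (𝓡 2) y,
        (∀ z ∈ s, IsParallelAt D T z) → (∃ z ∈ N, T z = 0) → ∀ z ∈ N, T z = 0 := by
  have hy : y ∈ (chartAt Plane y).source := mem_chart_source _ _
  obtain ⟨r, hr, hball⟩ := Metric.eventually_nhds_iff_ball.1
    ((eventually_symm_mem hy hs).and
      ((isOpen_extChartAt_target y).mem_nhds (extChartAt_mem_target hy)))
  -- The preimage of a ball is convex in the chart, and it is chosen before `T`: a zero anywhere in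
  -- it forces `T` to vanish on all of it. This symmetry makes vanishing a locally constant
  -- property.
  refine ⟨(chartAt Plane y).source ∩ extChartAt (𝓡 2) y ⁻¹' Metric.ball (extChartAt (𝓡 2) y y) r,
    Filter.inter_mem ((chartAt Plane y).open_source.mem_nhds hy)
      ((continuousAt_extChartAt_of_mem hy) (Metric.ball_mem_nhds _ hr)), ?_⟩
  rintro T hT ⟨z, ⟨hz, hzb⟩, hz0⟩ z' ⟨hz', hzb'⟩
  rw [endo_eq_zero_iff hz] at hz0
  rw [endo_eq_zero_iff hz']
  refine eqOn_zero_of_hasFDerivAt_flip (convex_ball _ _) (A := parallelForm D y)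
    ((contDiffOn_parallelForm D y).continuousOn.mono fun p hp => (hball p hp).2)
    (fun p hp => ?_) hzb hz0 hzb'
  have h := ((isParallelAt_iff D (extChartAt_symm_mem_source (hball p hp).2)).1
    (hT _ (hball p hp).1)).2
  rwa [(extChartAt (𝓡 2) y).right_inv (hball p hp).2] at h

/-- A parallel field of endomorphisms vanishing at one point vanishes identically. -/
theorem eq_zero_of_isParallelAt [T2Space M] [PreconnectedSpace M] (D : AffineConnection M)
    {T : Π y : M, TangentSpace (𝓡 2) y →L[ℝ] TangentSpace (𝓡 2) y}
    (hT : ∀ y, IsParallelAt D T y) {x : M} (hx : T x = 0) (z : M) : T z = 0 := by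
  have hloc : IsLocallyConstant (fun y => T y = 0) := by
    refine (IsLocallyConstant.iff_exists_open _).2 fun y => ?_
    obtain ⟨N, hN, h⟩ := exists_nhds_forall_eq_zero D (y := y) Filter.univ_mem
    obtain ⟨U, hUN, hU, hyU⟩ := mem_nhds_iff.1 hN
    refine ⟨U, hU, hyU, fun z hz => propext ⟨fun h0 => ?_, fun h0 => ?_⟩⟩
    · exact h T (fun z _ => hT z) ⟨z, hUN hz, h0⟩ y (hUN hyU)
    · exact h T (fun z _ => hT z) ⟨y, hUN hyU, h0⟩ z (hUN hz)
  exact (hloc.apply_eq_of_preconnectedSpace x z).mp hx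

end ParallelTensors

end AffineSurface

/-! ### Parallel extension when the curvature is scalar -/

namespace AffineSurface

noncomputable section ParallelExtension

set_option maxSynthPendingDepth 3

variable {M : Type*} [TopologicalSpace M] [ChartedSpace (EuclideanSpace ℝ (Fin 2)) M]
  [IsManifold (𝓡 2) ∞ M] {x₀ y : M}

/-- The curvature operators of `D` are multiples of the identity. -/
def HasScalarCurvatureOperators [T2Space M] (D : AffineConnection M) : Prop :=
  ∀ (x : M) (u v : TangentSpace (𝓡 2) x), ∃ c : ℝ, ∀ w, curvature D w u v = c • w

theorem HasScalarCurvatureOperators.curvatureForm_eq [T2Space M] {D : AffineConnection M}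
    (h : HasScalarCurvatureOperators D) {p : Plane} (hp : p ∈ (extChartAt (𝓡 2) x₀).target)
    (u v : Plane) : ∃ c : ℝ, curvatureForm D x₀ p u v = c • 1 := by
  have hy := extChartAt_symm_mem_source hp
  obtain ⟨c, hc⟩ := h _ (ofModel x₀ ((extChartAt (𝓡 2) x₀).symm p) u)
    (ofModel x₀ ((extChartAt (𝓡 2) x₀).symm p) v)
  refine ⟨c, ?_⟩
  ext1 w
  have h1 := toModel_curvature D hy u v (ofModel x₀ ((extChartAt (𝓡 2) x₀).symm p) w)
  rw [(extChartAt (𝓡 2) x₀).right_inv hp, hc, map_smul, toModel_ofModel hy] at h1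
  exact h1.symm

-- The obstruction to integrability is the commutator with `curvatureForm`, and a multiple of the
-- identity commutes with every `S`.
set_option synthInstance.maxHeartbeats 200000 in
theorem HasScalarCurvatureOperators.parallelForm_flat [T2Space M] {D : AffineConnection M}
    (h : HasScalarCurvatureOperators D) {p : Plane} (hp : p ∈ (extChartAt (𝓡 2) x₀).target)
    (u v : Plane) :
    fderiv ℝ (parallelForm D x₀) p u v + parallelForm D x₀ p v ∘L parallelForm D x₀ p u =
      fderiv ℝ (parallelForm D x₀) p v u + parallelForm D x₀ p u ∘L parallelForm D x₀ p v := by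
  obtain ⟨c, hc⟩ := h.curvatureForm_eq hp u v
  have hΓ : DifferentiableAt ℝ (christoffel D x₀) p :=
    ((contDiffOn_christoffel D x₀).contDiffAt
      ((isOpen_extChartAt_target x₀).mem_nhds hp)).differentiableAt (by simp)
  have hd : ∀ u v, fderiv ℝ (parallelForm D x₀) p u v =
      commutatorCLM (fderiv ℝ (christoffel D x₀) p u v) := by
    intro u v
    have h1 : HasFDerivAt (parallelForm D x₀) _ p :=
      (hasFDerivAt_const commutatorCLM p).clm_comp hΓ.hasFDerivAt
    rw [h1.fderiv]
    simp
  rw [hd, hd]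
  ext1 S
  have h2 : fderiv ℝ (christoffel D x₀) p u v = c • 1 + fderiv ℝ (christoffel D x₀) p v u -
      (christoffel D x₀ p u * christoffel D x₀ p v -
        christoffel D x₀ p v * christoffel D x₀ p u) := by
    rw [← hc, curvatureForm]
    simp only [ContinuousLinearMap.mul_def]
    abel
  simp only [add_apply, ContinuousLinearMap.comp_apply, parallelForm, commutatorCLM_apply, h2]
  have h3 : S * (c • (1 : Plane →L[ℝ] Plane)) = (c • (1 : Plane →L[ℝ] Plane)) * S := by
    rw [mul_smul_comm, smul_mul_assoc, mul_one, one_mul]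
  simp only [mul_add, add_mul, mul_sub, sub_mul, h3, mul_assoc]
  abel

/-- The field of endomorphisms with given components in the chart at `x₀`. -/
def ofCoord (x₀ : M) (F : Plane → Plane →L[ℝ] Plane) (y : M) :
    TangentSpace (𝓡 2) y →L[ℝ] TangentSpace (𝓡 2) y :=
  ofModel x₀ y ∘L F (extChartAt (𝓡 2) x₀ y) ∘L toModel x₀ y

theorem endoCoord_ofCoord (hy : y ∈ (chartAt Plane x₀).source) (F : Plane → Plane →L[ℝ] Plane) :
    endoCoord x₀ (ofCoord x₀ F) =ᶠ[𝓝 (extChartAt (𝓡 2) x₀ y)] F := by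
  filter_upwards [(isOpen_extChartAt_target x₀).mem_nhds (extChartAt_mem_target hy)] with p hp
  have hs := extChartAt_symm_mem_source hp
  ext1 w
  simp only [endoCoord_apply_apply, ofCoord, ContinuousLinearMap.comp_apply, toModel_ofModel hs,
    (extChartAt (𝓡 2) x₀).right_inv hp]

theorem bijective_conj_ofModel (hy : y ∈ (chartAt Plane x₀).source) :
    Function.Bijective (fun S : Plane →L[ℝ] Plane => ofModel x₀ y ∘L S ∘L toModel x₀ y) := by
  refine Function.bijective_iff_has_inverse.2
    ⟨fun T => toModel x₀ y ∘L T ∘L ofModel x₀ y, fun S => ?_, fun T => ?_⟩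
  · ext1 w
    simp only [ContinuousLinearMap.comp_apply, toModel_ofModel hy]
  · ext1 w
    simp only [ContinuousLinearMap.comp_apply, ofModel_toModel hy]

/-- Local frames of parallel fields of endomorphisms. -/
theorem HasScalarCurvatureOperators.exists_parallel_frame [T2Space M] {D : AffineConnection M}
    (h : HasScalarCurvatureOperators D) (x₀ : M) : ∃ U : Set M, IsOpen U ∧ x₀ ∈ U ∧
      ∃ s : (y : M) → (Plane →L[ℝ] Plane) → TangentSpace (𝓡 2) y →L[ℝ] TangentSpace (𝓡 2) y,
        (∀ w, ∀ y ∈ U, IsParallelAt D (fun y => s y w) y) ∧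
          ∀ y ∈ U, Function.Bijective (s y) := by
  have hx₀ : x₀ ∈ (chartAt Plane x₀).source := mem_chart_source _ _
  obtain ⟨r, hr, hrV, hF⟩ := exists_hasFDerivAt_flip (isOpen_extChartAt_target (I := 𝓡 2) x₀)
    (contDiffOn_parallelForm D x₀) (fun p hp => h.parallelForm_flat hp)
    (extChartAt_mem_target hx₀)
  choose F hF0 hF using hF
  have hAc := (contDiffOn_parallelForm D x₀).continuousOn.mono hrV
  have hzero : ∀ G : Plane → Plane →L[ℝ] Plane,
      (∀ p ∈ Metric.ball (extChartAt (𝓡 2) x₀ x₀) r,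
        HasFDerivAt G ((parallelForm D x₀ p).flip (G p)) p) →
      ∀ p ∈ Metric.ball (extChartAt (𝓡 2) x₀ x₀) r, G p = 0 →
      ∀ q ∈ Metric.ball (extChartAt (𝓡 2) x₀ x₀) r, G q = 0 := fun G hG p hp h0 q hq =>
    eqOn_zero_of_hasFDerivAt_flip (convex_ball _ _) hAc hG hp h0 hq
  have hc := Metric.mem_ball_self (x := extChartAt (𝓡 2) x₀ x₀) hr
  -- By uniqueness the value at `p` is linear in the initial value, and injective because a solution
  -- vanishing at `p` vanishes at the centre; finite dimension gives surjectivity.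
  have hbij : ∀ p ∈ Metric.ball (extChartAt (𝓡 2) x₀ x₀) r,
      Function.Bijective (fun w => F w p) := by
    intro p hp
    let L : (Plane →L[ℝ] Plane) →ₗ[ℝ] (Plane →L[ℝ] Plane) :=
      { toFun := fun w => F w p
        map_add' := fun w w' => by
          have := hzero (fun q => F (w + w') q - (F w q + F w' q)) (fun q hq => by
            rw [map_sub, map_add]
            exact (hF _ q hq).sub ((hF _ q hq).add (hF _ q hq))) _ hc
            (by simp only [hF0, sub_self]) p hp
          exact sub_eq_zero.1 this
        map_smul' := fun c w => by
          have := hzero (fun q => F (c • w) q - c • F w q) (fun q hq => by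
            rw [map_sub, map_smul]
            exact (hF _ q hq).sub ((hF _ q hq).const_smul c)) _ hc
            (by simp only [hF0, sub_self]) p hp
          exact sub_eq_zero.1 this }
    have hinj : Function.Injective L := by
      rw [injective_iff_map_eq_zero]
      intro w hw
      have := hzero (F w) (hF w) p hp hw _ hc
      rwa [hF0] at this
    exact ⟨hinj, LinearMap.injective_iff_surjective.1 hinj⟩
  refine ⟨(extChartAt (𝓡 2) x₀).source ∩
    extChartAt (𝓡 2) x₀ ⁻¹' Metric.ball (extChartAt (𝓡 2) x₀ x₀) r,
    (continuousOn_extChartAt x₀).isOpen_inter_preimage (isOpen_extChartAt_source x₀)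
      Metric.isOpen_ball, ⟨mem_extChartAt_source x₀, hc⟩, fun y w => ofCoord x₀ (F w) y, ?_, ?_⟩
  · rintro w y ⟨hy, hyb⟩
    rw [extChartAt_source] at hy
    have e := endoCoord_ofCoord hy (F w)
    have hsm := contDiffOn_of_hasFDerivAt_flip Metric.isOpen_ball
      ((contDiffOn_parallelForm D x₀).mono hrV) (hF w)
    refine (isParallelAt_iff D hy).2 ⟨?_, ?_⟩
    · exact (hsm.contDiffAt (Metric.isOpen_ball.mem_nhds hyb)).congr_of_eventuallyEq e
    · change HasFDerivAt (endoCoord x₀ (ofCoord x₀ (F w))) ((parallelForm D x₀ _).flip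
        (endoCoord x₀ (ofCoord x₀ (F w)) _)) _
      rw [e.eq_of_nhds]
      exact (hF w _ hyb).congr_of_eventuallyEq e
  · rintro y ⟨hy, hyb⟩
    rw [extChartAt_source] at hy
    exact (bijective_conj_ofModel hy).comp (hbij _ hyb)

/-- If the curvature operators are multiples of the identity and `M` is simply connected, every
endomorphism of a tangent space extends to a parallel field of endomorphisms. -/
theorem HasScalarCurvatureOperators.exists_parallel_extension [T2Space M] [SimplyConnectedSpace M]
    {D : AffineConnection M} (h : HasScalarCurvatureOperators D) (x₀ : M)
    (S : TangentSpace (𝓡 2) x₀ →L[ℝ] TangentSpace (𝓡 2) x₀) :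
    ∃ T : Π y : M, TangentSpace (𝓡 2) y →L[ℝ] TangentSpace (𝓡 2) y,
      T x₀ = S ∧ ∀ y, IsParallelAt D T y := by
  have : LocallyPathConnectedSpace M := ChartedSpace.locallyPathConnectedSpace Plane M
  choose U hU hmem s hs hbij using h.exists_parallel_frame
  obtain ⟨T, hT0, hT⟩ := exists_section_of_locallyConstant_transition
    (B := fun y : M => TangentSpace (𝓡 2) y →L[ℝ] TangentSpace (𝓡 2) y) U hU hmem s hbij
    -- The difference of two local parallel fields agreeing at `x` vanishes near `x`, so the
    -- transition functions are locally constant.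
    (fun i j x hi hj f g hfg => by
      obtain ⟨N, hN, hz⟩ := exists_nhds_forall_eq_zero D (((hU i).inter (hU j)).mem_nhds ⟨hi, hj⟩)
      filter_upwards [hN] with y hy
      exact sub_eq_zero.1 (hz (fun y => s i y f - s j y g)
        (fun z hz => (hs i f z hz.1).sub (hs j g z hz.2))
        ⟨x, mem_of_mem_nhds hN, sub_eq_zero.2 hfg⟩ y hy)) x₀ S
  refine ⟨T, hT0, fun y => ?_⟩
  obtain ⟨f, hf⟩ := hT y y (hmem y)
  exact (hs y f y (hmem y)).congr (hf.mono fun z hz => hz.symm)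

/-- Parallel fields of endomorphisms commute with the curvature operators. -/
theorem IsParallelAt.apply_curvature [T2Space M] {D : AffineConnection M}
    {T : Π y : M, TangentSpace (𝓡 2) y →L[ℝ] TangentSpace (𝓡 2) y}
    (hT : ∀ y, IsParallelAt D T y) {x : M} (u v w : TangentSpace (𝓡 2) x) :
    T x (curvature D w u v) = curvature D (T x w) u v := by
  have hx : x ∈ (chartAt Plane x).source := mem_chart_source _ _
  have ho := (chartAt Plane x).open_source
  obtain ⟨u, rfl⟩ : ∃ u', u = ofModel x x u' := ⟨_, (ofModel_toModel hx u).symm⟩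
  obtain ⟨v, rfl⟩ : ∃ v', v = ofModel x x v' := ⟨_, (ofModel_toModel hx v).symm⟩
  obtain ⟨w, rfl⟩ : ∃ w', w = constField x w' x := ⟨_, (ofModel_toModel hx w).symm⟩
  have hZ := smoothOn_constField x w
  have hTZ : SmoothOn (fun y => T y (constField x w y)) (chartAt Plane x).source := fun y hy =>
    ((hT y).1.clm_bundle_apply (hZ.contMDiffAt (ho.mem_nhds hy))).contMDiffWithinAt
  -- `T` passes through both covariant derivatives; the inner one requires parallelism on a
  -- neighbourhood, not just at `x`.
  have h2 : ∀ u v : Plane, D.cov (fun y => D.cov (fun y => T y (constField x w y)) y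
      (constField x v y)) x (constField x u x) =
      T x (D.cov (fun y => D.cov (constField x w) y (constField x v y)) x (constField x u x)) := by
    intro u v
    rw [← (hT x).2 _ (mdifferentiableAt_cov D ho hx hZ (diffAt_constField hx v))]
    refine congrArg (fun L => L (constField x u x)) (cov_congr D
      (mdifferentiableAt_cov D ho hx hTZ (diffAt_constField hx v)) ?_)
    filter_upwards [ho.mem_nhds hx] with y hy
    exact (hT y).2 _ (diffAt_constField hy w) _
  rw [curvature_eq_curvatureAux D ho hx hZ, curvature_eq_curvatureAux D ho hx hTZ]
  simp only [curvatureAux, h2, map_sub, (hT x).2 _ (diffAt_constField hx w)]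

theorem isParallelAt_of_mem {D : AffineConnection M} {T : TensorOneOne M}
    (hT : T ∈ parallelTensors D) (y : M) : IsParallelAt D T y :=
  ⟨T.contMDiff y, fun X hX v => hT X y hX v⟩

theorem exists_mem_parallelTensors {D : AffineConnection M}
    {T : Π y : M, TangentSpace (𝓡 2) y →L[ℝ] TangentSpace (𝓡 2) y}
    (hT : ∀ y, IsParallelAt D T y) :
    ∃ T' ∈ parallelTensors D, ∀ y, T' y = T y :=
  ⟨⟨T, fun y => (hT y).1⟩, fun X x hX v => (hT x).2 X hX v, fun _ => rfl⟩

end ParallelExtension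

end AffineSurface

/-! ### The Ricci tensor and the curvature operator -/

namespace AffineSurface

noncomputable section RicciTensor

set_option maxSynthPendingDepth 3

variable {M : Type*} [TopologicalSpace M] [ChartedSpace (EuclideanSpace ℝ (Fin 2)) M]

/-- The standard basis of a tangent space. -/
def tangentBasis (x : M) : Module.Basis (Fin 2) ℝ (TangentSpace (𝓡 2) x) :=
  (EuclideanSpace.basisFun (Fin 2) ℝ).toBasis

/-- The matrix of an endomorphism of a tangent space. -/
def endoMatrix (x : M) :
    (TangentSpace (𝓡 2) x →L[ℝ] TangentSpace (𝓡 2) x) ≃ₗ[ℝ] Matrix (Fin 2) (Fin 2) ℝ :=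
  (LinearMap.toContinuousLinearMap (𝕜 := ℝ) (E := Plane) (F' := Plane)).symm ≪≫ₗ
    LinearMap.toMatrix (tangentBasis x) (tangentBasis x)

theorem endoMatrix_apply (x : M) (T : TangentSpace (𝓡 2) x →L[ℝ] TangentSpace (𝓡 2) x) :
    endoMatrix x T = LinearMap.toMatrix (tangentBasis x) (tangentBasis x) T.toLinearMap := rfl

theorem endoMatrix_comp (x : M) (S T : TangentSpace (𝓡 2) x →L[ℝ] TangentSpace (𝓡 2) x) :
    endoMatrix x (S ∘L T) = endoMatrix x S * endoMatrix x T :=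
  LinearMap.toMatrix_comp _ (tangentBasis x) _ S.toLinearMap T.toLinearMap

theorem endoMatrix_id (x : M) :
    endoMatrix x (ContinuousLinearMap.id ℝ (TangentSpace (𝓡 2) x)) = 1 :=
  LinearMap.toMatrix_id (tangentBasis x)

theorem trace_endoMatrix (x : M) (T : TangentSpace (𝓡 2) x →L[ℝ] TangentSpace (𝓡 2) x) :
    (endoMatrix x T).trace = LinearMap.trace ℝ (TangentSpace (𝓡 2) x) T.toLinearMap :=
  (LinearMap.trace_eq_matrix_trace ℝ (tangentBasis x) _).symm

variable [IsManifold (𝓡 2) ∞ M] [T2Space M]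

theorem curvature_swap (D : AffineConnection M) {x : M} (u v w : TangentSpace (𝓡 2) x) :
    curvature D w u v = - curvature D w v u := by
  rw [curvature_eq, curvature_eq, curvatureAux_swap]

theorem curvature_self (D : AffineConnection M) {x : M} (u w : TangentSpace (𝓡 2) x) :
    curvature D w u u = 0 := by
  have h := curvature_swap D u u w
  have h2 : (2 : ℝ) • curvature D w u u = 0 := by
    rw [two_smul]
    nth_rewrite 1 [h]
    exact neg_add_cancel _
  exact (smul_eq_zero.1 h2).resolve_left two_ne_zero

/-- The curvature operator of the standard basis of the tangent space. -/
def curvatureOperator (D : AffineConnection M) (x : M) :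
    TangentSpace (𝓡 2) x →ₗ[ℝ] TangentSpace (𝓡 2) x where
  toFun w := curvature D w (tangentBasis x 0) (tangentBasis x 1)
  map_add' w w' := by rw [curvature_add]; rfl
  map_smul' c w := by rw [curvature_smul]; rfl

/-- The curvature is alternating in its two direction arguments, so on a plane it is the value on
the basis times the area of `u` and `v`. -/
theorem curvature_eq_curvatureOperator (D : AffineConnection M) {x : M}
    (u v w : TangentSpace (𝓡 2) x) : curvature D w u v =
      ((tangentBasis x).repr u 0 * (tangentBasis x).repr v 1 -
        (tangentBasis x).repr u 1 * (tangentBasis x).repr v 0) • curvatureOperator D x w := by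
  have hu := (tangentBasis x).sum_repr u
  have hv := (tangentBasis x).sum_repr v
  rw [Fin.sum_univ_two] at hu hv
  conv_lhs => rw [← hu, ← hv]
  have h10 : curvature D w (tangentBasis x 1) (tangentBasis x 0) = - curvatureOperator D x w :=
    curvature_swap D _ _ _
  have h01 : curvature D w (tangentBasis x 0) (tangentBasis x 1) = curvatureOperator D x w := rfl
  simp only [map_add, map_smul, add_apply, smul_apply, curvature_self, h10, h01]
  module

/-- The matrix of the curvature operator. -/
def curvatureMatrix (D : AffineConnection M) (x : M) : Matrix (Fin 2) (Fin 2) ℝ :=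
  LinearMap.toMatrix (tangentBasis x) (tangentBasis x) (curvatureOperator D x)

theorem ricci_apply (D : AffineConnection M) {x : M} (v w : TangentSpace (𝓡 2) x) :
    ricci D x v w = (tangentBasis x).repr v 1 * (tangentBasis x).repr (curvatureOperator D x w) 0 -
      (tangentBasis x).repr v 0 * (tangentBasis x).repr (curvatureOperator D x w) 1 := by
  change LinearMap.trace ℝ (TangentSpace (𝓡 2) x) (curvatureEndo D v w) = _
  rw [LinearMap.trace_eq_matrix_trace ℝ (tangentBasis x), Matrix.trace_fin_two,
    LinearMap.toMatrix_apply, LinearMap.toMatrix_apply]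
  have h : ∀ z, curvatureEndo D v w z = curvature D w z v := fun _ => rfl
  rw [h, h, curvature_eq_curvatureOperator, curvature_eq_curvatureOperator]
  simp
  ring

theorem ricciSymm_apply (D : AffineConnection M) {x : M} (v w : TangentSpace (𝓡 2) x) :
    ricciSymm D x v w = (1 / 2) * (ricci D x v w + ricci D x w v) := by
  simp [ricciSymm]
  ring

theorem ricciSymm_comm (D : AffineConnection M) {x : M} (v w : TangentSpace (𝓡 2) x) :
    ricciSymm D x v w = ricciSymm D x w v := by
  rw [ricciSymm_apply, ricciSymm_apply, add_comm]

theorem ricciSymm_basis_zero_zero (D : AffineConnection M) (x : M) :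
    ricciSymm D x (tangentBasis x 0) (tangentBasis x 0) = - curvatureMatrix D x 1 0 := by
  simp [ricciSymm_apply, ricci_apply, curvatureMatrix, LinearMap.toMatrix_apply]
  ring

theorem ricciSymm_basis_zero_one (D : AffineConnection M) (x : M) :
    ricciSymm D x (tangentBasis x 0) (tangentBasis x 1) =
      (curvatureMatrix D x 0 0 - curvatureMatrix D x 1 1) / 2 := by
  simp [ricciSymm_apply, ricci_apply, curvatureMatrix, LinearMap.toMatrix_apply]
  ring

theorem ricciSymm_basis_one_one (D : AffineConnection M) (x : M) :
    ricciSymm D x (tangentBasis x 1) (tangentBasis x 1) = curvatureMatrix D x 0 1 := by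
  simp [ricciSymm_apply, ricci_apply, curvatureMatrix, LinearMap.toMatrix_apply]
  ring

/-- Symmetrizing `ρ` discards the trace of the curvature operator and keeps exactly its trace free
part. -/
theorem ricciSymm_eq_zero_iff (D : AffineConnection M) (x : M) : ricciSymm D x = 0 ↔
    (curvatureMatrix D x 0 0 - curvatureMatrix D x 1 1) / 2 = 0 ∧ curvatureMatrix D x 0 1 = 0 ∧
      curvatureMatrix D x 1 0 = 0 := by
  rw [bilin_eq_zero_iff (tangentBasis x) (ricciSymm_comm D), ricciSymm_basis_zero_zero,
    ricciSymm_basis_zero_one, ricciSymm_basis_one_one, neg_eq_zero]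
  tauto

/-- If the symmetric Ricci tensor vanishes, the curvature operators are multiples of the
identity. -/
theorem hasScalarCurvatureOperators_of_ricciSymm_eq_zero (D : AffineConnection M)
    (h : ∀ x, ricciSymm D x = 0) : HasScalarCurvatureOperators D := by
  intro x u v
  obtain ⟨h0, h1, h2⟩ := (ricciSymm_eq_zero_iff D x).1 (h x)
  have hA : ∀ w, curvatureOperator D x w = curvatureMatrix D x 0 0 • w := by
    have : curvatureOperator D x = curvatureMatrix D x 0 0 • LinearMap.id := by
      apply (LinearMap.toMatrix (tangentBasis x) (tangentBasis x)).injective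
      rw [map_smul, LinearMap.toMatrix_id]
      change curvatureMatrix D x = _
      ext i j
      fin_cases i <;> fin_cases j <;> simp [h1, h2]
      linarith
    intro w
    rw [this]
    rfl
  exact ⟨_, fun w => by rw [curvature_eq_curvatureOperator, hA, smul_smul]⟩

end RicciTensor

end AffineSurface

/-! ### Dimension of the space of parallel tensors, and type of its elements -/

namespace AffineSurface

noncomputable section Classification

set_option maxSynthPendingDepth 3

variable {M : Type*} [TopologicalSpace M] [ChartedSpace (EuclideanSpace ℝ (Fin 2)) M]
  [IsManifold (𝓡 2) ∞ M]

/-- The matrix at `x` of a trace free parallel tensor. -/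
def evalMatrix (D : AffineConnection M) (x : M) :
    traceFreeParallelTensors D →ₗ[ℝ] Matrix (Fin 2) (Fin 2) ℝ where
  toFun T := endoMatrix x (T.1 x)
  map_add' S T := (endoMatrix x).map_add (S.1 x) (T.1 x)
  map_smul' c T := (endoMatrix x).map_smul c (T.1 x)

theorem evalMatrix_apply (D : AffineConnection M) (x : M) (T : traceFreeParallelTensors D) :
    evalMatrix D x T = endoMatrix x (T.1 x) := rfl

theorem trace_evalMatrix (D : AffineConnection M) (x : M) (T : traceFreeParallelTensors D) :
    (evalMatrix D x T).trace = 0 := by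
  rw [evalMatrix_apply, trace_endoMatrix]
  exact T.2.2 x

theorem evalMatrix_one_one (D : AffineConnection M) (x : M) (T : traceFreeParallelTensors D) :
    evalMatrix D x T 1 1 = - evalMatrix D x T 0 0 := by
  have h := trace_evalMatrix D x T
  rw [Matrix.trace_fin_two] at h
  linarith

theorem isParallelAt_coe {D : AffineConnection M} (T : traceFreeParallelTensors D) (y : M) :
    IsParallelAt D T.1 y := isParallelAt_of_mem T.2.1 y

theorem admitsKahler_of_comp_self {D : AffineConnection M} (T : traceFreeParallelTensors D)
    {c : ℝ} (hc : c < 0)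
    (hT : ∀ y, T.1 y ∘L T.1 y = c • ContinuousLinearMap.id ℝ (TangentSpace (𝓡 2) y)) :
    AdmitsKahler D := by
  refine ⟨(√(-c))⁻¹ • T.1, Submodule.smul_mem _ _ T.2, fun y => ?_⟩
  change ((√(-c))⁻¹ • T.1 y) ∘L ((√(-c))⁻¹ • T.1 y) = _
  rw [ContinuousLinearMap.smul_comp, ContinuousLinearMap.comp_smul, hT, smul_smul, smul_smul,
    ← mul_inv, Real.mul_self_sqrt (by linarith), inv_neg, neg_mul, inv_mul_cancel₀ hc.ne, neg_smul,
    one_smul]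

theorem admitsParaKahler_of_comp_self {D : AffineConnection M} (T : traceFreeParallelTensors D)
    {c : ℝ} (hc : 0 < c)
    (hT : ∀ y, T.1 y ∘L T.1 y = c • ContinuousLinearMap.id ℝ (TangentSpace (𝓡 2) y)) :
    AdmitsParaKahler D := by
  refine ⟨(√c)⁻¹ • T.1, Submodule.smul_mem _ _ T.2, fun y => ?_⟩
  change ((√c)⁻¹ • T.1 y) ∘L ((√c)⁻¹ • T.1 y) = _
  rw [ContinuousLinearMap.smul_comp, ContinuousLinearMap.comp_smul, hT, smul_smul, smul_smul,
    ← mul_inv, Real.mul_self_sqrt hc.le, inv_mul_cancel₀ hc.ne', one_smul]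

theorem admitsNilpotentKahler_of_comp_self {D : AffineConnection M}
    (T : traceFreeParallelTensors D) (hT0 : T ≠ 0)
    (hT : ∀ y, T.1 y ∘L T.1 y = (0 : ℝ) • ContinuousLinearMap.id ℝ (TangentSpace (𝓡 2) y)) :
    AdmitsNilpotentKahler D := by
  refine ⟨T.1, T.2, fun h => hT0 (Subtype.ext h), fun y => ⟨2, ?_⟩⟩
  rw [pow_two]
  exact (hT y).trans (zero_smul _ _)

/-- In a one-dimensional space the second structure is `c` times the first, and squaring would give
`1 = -c²`. -/
theorem not_admitsKahler_and_admitsParaKahler [Nonempty M] {D : AffineConnection M}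
    (h : Module.finrank ℝ (traceFreeParallelTensors D) = 1) :
    ¬ (AdmitsKahler D ∧ AdmitsParaKahler D) := by
  rintro ⟨⟨S, hS, hS'⟩, ⟨T, hT, hT'⟩⟩
  obtain ⟨x⟩ := ‹Nonempty M›
  have hS0 : (⟨S, hS⟩ : traceFreeParallelTensors D) ≠ 0 := by
    intro h0
    have h1 : S = 0 := congrArg Subtype.val h0
    have h2 := congrArg (endoMatrix x) (hS' x)
    rw [endoMatrix_comp, map_neg, endoMatrix_id, h1] at h2
    have h3 : endoMatrix x ((0 : TensorOneOne M) x) = 0 := (endoMatrix x).map_zero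
    rw [h3] at h2
    simpa using congrFun (congrFun h2 0) 0
  obtain ⟨c, hc⟩ := (finrank_eq_one_iff_of_nonzero' _ hS0).1 h ⟨T, hT⟩
  have h1 : T x = c • S x := by
    have h0 : c • S = T := congrArg Subtype.val hc
    rw [← h0]
    rfl
  have h2 := congrArg (endoMatrix x) (hT' x)
  have h3 := congrArg (endoMatrix x) (hS' x)
  rw [endoMatrix_comp, map_neg, endoMatrix_id] at h3
  rw [endoMatrix_comp, endoMatrix_id, h1, map_smul, smul_mul_smul_comm, h3] at h2
  have h4 := congrFun (congrFun h2 0) 0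
  simp at h4
  nlinarith [mul_self_nonneg c]

variable [T2Space M]

theorem evalMatrix_mul_curvatureMatrix (D : AffineConnection M) (x : M)
    (T : traceFreeParallelTensors D) :
    evalMatrix D x T * curvatureMatrix D x = curvatureMatrix D x * evalMatrix D x T := by
  rw [evalMatrix_apply, endoMatrix_apply, curvatureMatrix,
    ← LinearMap.toMatrix_comp _ (tangentBasis x), ← LinearMap.toMatrix_comp _ (tangentBasis x)]
  congr 1
  refine LinearMap.ext fun w => ?_
  exact IsParallelAt.apply_curvature (isParallelAt_coe T) (tangentBasis x 0) (tangentBasis x 1) w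

theorem cross_evalMatrix_eq_zero (D : AffineConnection M) (x : M)
    (T : traceFreeParallelTensors D) :
    evalMatrix D x T 0 0 * curvatureMatrix D x 0 1 =
        evalMatrix D x T 0 1 * ((curvatureMatrix D x 0 0 - curvatureMatrix D x 1 1) / 2) ∧
      evalMatrix D x T 0 0 * curvatureMatrix D x 1 0 =
        evalMatrix D x T 1 0 * ((curvatureMatrix D x 0 0 - curvatureMatrix D x 1 1) / 2) ∧
      evalMatrix D x T 0 1 * curvatureMatrix D x 1 0 =
        evalMatrix D x T 1 0 * curvatureMatrix D x 0 1 :=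
  cross_eq_zero_of_commute (trace_evalMatrix D x T) (evalMatrix_mul_curvatureMatrix D x T)

theorem evalMatrix_injective [PreconnectedSpace M] (D : AffineConnection M) (x : M) :
    Function.Injective (evalMatrix D x) := by
  rw [injective_iff_map_eq_zero]
  intro T hT
  have h0 : T.1 x = 0 := (endoMatrix x).map_eq_zero_iff.1 hT
  apply Subtype.ext
  ext1 y
  exact eq_zero_of_isParallelAt D (isParallelAt_coe T) h0 y

/-- Evaluation at `x` is injective and lands in the line spanned by the trace free part of the
curvature operator, which is nonzero because `ρ_s` is. -/
theorem finrank_traceFreeParallelTensors_le_one [PreconnectedSpace M] (D : AffineConnection M)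
    {x : M} (hx : ricciSymm D x ≠ 0) : Module.finrank ℝ (traceFreeParallelTensors D) ≤ 1 := by
  rw [Ne, ricciSymm_eq_zero_iff] at hx
  let A : Matrix (Fin 2) (Fin 2) ℝ := !![(curvatureMatrix D x 0 0 - curvatureMatrix D x 1 1) / 2,
    curvatureMatrix D x 0 1; curvatureMatrix D x 1 0,
    -((curvatureMatrix D x 0 0 - curvatureMatrix D x 1 1) / 2)]
  have hmem : ∀ T, evalMatrix D x T ∈ Submodule.span ℝ {A} := by
    intro T
    obtain ⟨h1, h2, h3⟩ := cross_evalMatrix_eq_zero D x T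
    obtain ⟨c, h4, h5, h6⟩ := exists_eq_mul_of_cross_eq_zero h1 h2 h3 hx
    rw [Submodule.mem_span_singleton]
    refine ⟨c, ?_⟩
    ext i j
    fin_cases i <;> fin_cases j <;> simp [A, h4, h5, h6, evalMatrix_one_one]
  refine (LinearMap.finrank_le_finrank_of_injective
    (f := (evalMatrix D x).codRestrict (Submodule.span ℝ {A}) hmem) ?_).trans
    ((finrank_span_le_card {A}).trans (by simp))
  exact fun S T h => evalMatrix_injective D x (congrArg Subtype.val h)

/-- A parallel tensor whose square is a multiple of the identity at one point has this property
everywhere. -/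
theorem comp_self_eq_smul_id [PreconnectedSpace M] (D : AffineConnection M)
    {T : Π y : M, TangentSpace (𝓡 2) y →L[ℝ] TangentSpace (𝓡 2) y}
    (hT : ∀ y, IsParallelAt D T y) {x : M} {c : ℝ}
    (hx : endoMatrix x (T x) * endoMatrix x (T x) = c • (1 : Matrix (Fin 2) (Fin 2) ℝ)) (y : M) :
    T y ∘L T y = c • ContinuousLinearMap.id ℝ (TangentSpace (𝓡 2) y) := by
  refine sub_eq_zero.1 (eq_zero_of_isParallelAt D
    (T := fun y => T y ∘L T y - c • ContinuousLinearMap.id ℝ (TangentSpace (𝓡 2) y))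
    (fun z => ((hT z).comp (hT z)).sub (isParallelAt_smul_id D c z)) (x := x) ?_ y)
  apply (endoMatrix x).injective
  rw [map_sub, endoMatrix_comp, map_smul, endoMatrix_id, hx, sub_self, map_zero]

/-- Cayley–Hamilton at `x` supplies `c`, and parallelism spreads it. Comparison with Cayley–Hamilton
at `y` shows that `c` is minus the determinant of `T` at every point. -/
theorem exists_comp_self_eq_smul_id [PreconnectedSpace M] (D : AffineConnection M)
    (T : traceFreeParallelTensors D) (x : M) : ∃ c : ℝ,
      (∀ y, T.1 y ∘L T.1 y = c • ContinuousLinearMap.id ℝ (TangentSpace (𝓡 2) y)) ∧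
      ∀ y, evalMatrix D y T 0 0 ^ 2 + evalMatrix D y T 0 1 * evalMatrix D y T 1 0 = c := by
  have h := comp_self_eq_smul_id D (isParallelAt_coe T)
    (sq_eq_smul_one_of_trace_eq_zero _ (trace_evalMatrix D x T))
  refine ⟨_, h, fun y => ?_⟩
  have h1 := congrArg (endoMatrix y) (h y)
  rw [endoMatrix_comp, map_smul, endoMatrix_id, ← evalMatrix_apply,
    sq_eq_smul_one_of_trace_eq_zero _ (trace_evalMatrix D y T)] at h1
  simpa using congrFun (congrFun h1 0) 0

/-- If the symmetric Ricci tensor vanishes, trace free endomorphisms of a tangent space extend to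
trace free parallel tensors. -/
theorem exists_evalMatrix_eq [SimplyConnectedSpace M] (D : AffineConnection M)
    (h : ∀ x, ricciSymm D x = 0) (x : M) {m : Matrix (Fin 2) (Fin 2) ℝ} (hm : m.trace = 0) :
    ∃ T, evalMatrix D x T = m := by
  obtain ⟨T, hTx, hT⟩ := (hasScalarCurvatureOperators_of_ricciSymm_eq_zero D
    h).exists_parallel_extension x ((endoMatrix x).symm m)
  have hTm : endoMatrix x (T x) = m := by rw [hTx, LinearEquiv.apply_symm_apply]
  obtain ⟨T', hT', e⟩ := exists_mem_parallelTensors hT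
  refine ⟨⟨T', hT', fun y => ?_⟩, ?_⟩
  · rw [e, ← trace_endoMatrix]
    -- The square of the extension is a constant multiple of the identity, so at `y` its trace
    -- vanishes or it is scalar. In the scalar case uniqueness makes it the same scalar at `x`,
    -- where the trace is zero.
    have hsq := congrArg (endoMatrix y) (comp_self_eq_smul_id D hT
      (by rw [hTm]; exact sq_eq_smul_one_of_trace_eq_zero m hm) y)
    rw [endoMatrix_comp, map_smul, endoMatrix_id] at hsq
    refine (trace_eq_zero_or_eq_smul_one _ hsq).elim id ?_
    rintro ⟨s, hs⟩
    have h0 := eq_zero_of_isParallelAt D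
      (T := fun y => T y - s • ContinuousLinearMap.id ℝ (TangentSpace (𝓡 2) y))
      (fun z => (hT z).sub (isParallelAt_smul_id D s z)) (x := y) (by
        apply (endoMatrix y).injective
        rw [map_sub, map_smul, endoMatrix_id, hs, sub_self, map_zero]) x
    have h1 : m = s • 1 := by
      rw [← hTm, sub_eq_zero.1 h0, map_smul, endoMatrix_id]
    rw [h1] at hm
    rw [hs]
    exact hm
  · rw [evalMatrix_apply]
    change endoMatrix x (T' x) = m
    rw [e, hTm]

/-- Uniqueness and extension identify the space with the trace free matrices at one point, which
have three free entries. -/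
theorem finrank_traceFreeParallelTensors_eq_three [SimplyConnectedSpace M]
    (D : AffineConnection M) (h : ∀ x, ricciSymm D x = 0) :
    Module.finrank ℝ (traceFreeParallelTensors D) = 3 := by
  obtain ⟨x⟩ : Nonempty M := inferInstance
  let f : traceFreeParallelTensors D →ₗ[ℝ] (Fin 3 → ℝ) :=
    { toFun := fun T => ![evalMatrix D x T 0 0, evalMatrix D x T 0 1, evalMatrix D x T 1 0]
      map_add' := fun S T => by
        ext i
        fin_cases i <;> simp
      map_smul' := fun c T => by
        ext i
        fin_cases i <;> simp }
  have hf : Function.Bijective f := by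
    constructor
    · intro S T hST
      have h0 : evalMatrix D x S 0 0 = evalMatrix D x T 0 0 := congrFun hST 0
      have h1 : evalMatrix D x S 0 1 = evalMatrix D x T 0 1 := congrFun hST 1
      have h2 : evalMatrix D x S 1 0 = evalMatrix D x T 1 0 := congrFun hST 2
      apply evalMatrix_injective D x
      ext i j
      fin_cases i <;> fin_cases j <;> simp [h0, h1, h2, evalMatrix_one_one]
    · intro c
      obtain ⟨T, hT⟩ := exists_evalMatrix_eq D h x (m := !![c 0, c 1; c 2, -c 0]) (by
        simp [Matrix.trace_fin_two])
      refine ⟨T, ?_⟩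
      ext i
      fin_cases i <;> simp [f, hT]
  rw [(LinearEquiv.ofBijective f hf).finrank_eq, Module.finrank_fin_fun]

/-- The rank of the symmetric Ricci tensor where it does not vanish, in terms of the square of a
trace free parallel tensor. -/
theorem ricciSymmRankAt_eq [PreconnectedSpace M] {D : AffineConnection M}
    {T : traceFreeParallelTensors D} (hT0 : T ≠ 0) {c : ℝ}
    (hc : ∀ y, evalMatrix D y T 0 0 ^ 2 + evalMatrix D y T 0 1 * evalMatrix D y T 1 0 = c)
    {x : M} (hx : ricciSymm D x ≠ 0) :
    ricciSymmRankAt D x = if c = 0 then 1 else 2 := by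
  obtain ⟨h1, h2, h3⟩ := cross_evalMatrix_eq_zero D x T
  have hne : ¬ (evalMatrix D x T 0 0 = 0 ∧ evalMatrix D x T 0 1 = 0 ∧
      evalMatrix D x T 1 0 = 0) := by
    rintro ⟨e0, e1, e2⟩
    refine hT0 (evalMatrix_injective D x ?_)
    ext i j
    fin_cases i <;> fin_cases j <;> simp [e0, e1, e2, evalMatrix_one_one]
  -- `T` is nonzero at `x`, so the proportionality can be read the other way: the trace free
  -- curvature is `l` times `T`.
  obtain ⟨l, h4, h5, h6⟩ := exists_eq_mul_of_cross_eq_zero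
    (x := (curvatureMatrix D x 0 0 - curvatureMatrix D x 1 1) / 2) (y := curvatureMatrix D x 0 1)
    (z := curvatureMatrix D x 1 0) (by linarith) (by linarith) (by linarith) hne
  have hdet : ricciSymm D x (tangentBasis x 0) (tangentBasis x 0) *
      ricciSymm D x (tangentBasis x 1) (tangentBasis x 1) -
      ricciSymm D x (tangentBasis x 0) (tangentBasis x 1) ^ 2 = -(l ^ 2 * c) := by
    rw [ricciSymm_basis_zero_zero, ricciSymm_basis_zero_one, ricciSymm_basis_one_one, h4, h5, h6,
      ← hc x]
    ring
  have hl : l ≠ 0 := by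
    rintro rfl
    rw [Ne, ricciSymm_eq_zero_iff, h4, h5, h6] at hx
    simp at hx
  split_ifs with h0
  · exact finrank_range_bilin_eq_one (tangentBasis x) (ricciSymm_comm D) hx (by
      rw [hdet, h0]; ring)
  · exact finrank_range_bilin_eq_two (tangentBasis x) (ricciSymm_comm D) (by
      rw [hdet]
      exact neg_ne_zero.2 (mul_ne_zero (pow_ne_zero 2 hl) h0))

end Classification

end AffineSurface

/-! ### Assembly of the classification -/

open AffineSurface in
theorem theorem1p5 (M : Type*) [TopologicalSpace M] [T2Space M] [SecondCountableTopology M]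
    [ChartedSpace (EuclideanSpace ℝ (Fin 2)) M] [IsManifold (𝓡 2) ∞ M]
    [SimplyConnectedSpace M] (D : AffineConnection M) :
    (Module.finrank ℝ (traceFreeParallelTensors D) = 1 →
      ((AdmitsKahler D ∧ RicciSymmHasRank D 2) ∨ (AdmitsParaKahler D ∧ RicciSymmHasRank D 2) ∨
        (AdmitsNilpotentKahler D ∧ RicciSymmHasRank D 1)) ∧
      ¬ ((AdmitsKahler D ∧ RicciSymmHasRank D 2) ∧ (AdmitsParaKahler D ∧ RicciSymmHasRank D 2)) ∧
      ¬ ((AdmitsKahler D ∧ RicciSymmHasRank D 2) ∧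
        (AdmitsNilpotentKahler D ∧ RicciSymmHasRank D 1)) ∧
      ¬ ((AdmitsParaKahler D ∧ RicciSymmHasRank D 2) ∧
        (AdmitsNilpotentKahler D ∧ RicciSymmHasRank D 1))) ∧
    Module.finrank ℝ (traceFreeParallelTensors D) ≠ 2 ∧
    (Module.finrank ℝ (traceFreeParallelTensors D) = 3 ↔ ∀ x : M, ricciSymm D x = 0) ∧
    ((∀ x : M, ricciSymm D x = 0) →
      AdmitsKahler D ∧ AdmitsParaKahler D ∧ AdmitsNilpotentKahler D) := by
  obtain ⟨x₀⟩ : Nonempty M := inferInstance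
  have hflat : (∀ x : M, ricciSymm D x = 0) →
      Module.finrank ℝ (traceFreeParallelTensors D) = 3 :=
    finrank_traceFreeParallelTensors_eq_three D
  have hcurved : ¬ (∀ x : M, ricciSymm D x = 0) →
      Module.finrank ℝ (traceFreeParallelTensors D) ≤ 1 := fun h => by
    obtain ⟨x, hx⟩ := not_forall.1 h
    exact finrank_traceFreeParallelTensors_le_one D hx
  have hranks : RicciSymmHasRank D 2 → ¬ RicciSymmHasRank D 1 := by
    rintro ⟨⟨x, hx⟩, h2⟩ ⟨-, h1⟩
    have := (h2 x hx).symm.trans (h1 x hx)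
    omega
  refine ⟨fun h => ⟨?_, fun hh => ?_, fun hh => hranks hh.1.2 hh.2.2,
    fun hh => hranks hh.1.2 hh.2.2⟩, fun h => ?_, ⟨fun h => ?_, hflat⟩, fun h => ?_⟩
  -- If `ρ_s` vanished identically, the dimension would be three.
  · have hne : ∃ x : M, ricciSymm D x ≠ 0 := by
      by_contra! hall
      have := hflat hall
      omega
    have : Nontrivial (traceFreeParallelTensors D) :=
      Module.nontrivial_of_finrank_pos (R := ℝ) (h ▸ one_pos)
    obtain ⟨T, hT0⟩ := exists_ne (0 : traceFreeParallelTensors D)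
    obtain ⟨c, hc, hc'⟩ := exists_comp_self_eq_smul_id D T x₀
    have hrank : RicciSymmHasRank D (if c = 0 then 1 else 2) :=
      ⟨hne, fun x hx => ricciSymmRankAt_eq hT0 hc' hx⟩
    rcases lt_trichotomy c 0 with h0 | h0 | h0
    · rw [if_neg h0.ne] at hrank
      exact Or.inl ⟨admitsKahler_of_comp_self T h0 hc, hrank⟩
    · rw [if_pos h0] at hrank
      subst h0
      exact Or.inr (Or.inr ⟨admitsNilpotentKahler_of_comp_self T hT0 hc, hrank⟩)
    · rw [if_neg h0.ne'] at hrank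
      exact Or.inr (Or.inl ⟨admitsParaKahler_of_comp_self T h0 hc, hrank⟩)
  · exact not_admitsKahler_and_admitsParaKahler h ⟨hh.1.1, hh.2.1⟩
  · by_cases hall : ∀ x : M, ricciSymm D x = 0
    · have := hflat hall
      omega
    · have := hcurved hall
      omega
  · by_contra hall
    have := hcurved hall
    omega
  · have key : ∀ a b d : ℝ, ∃ T : traceFreeParallelTensors D,
        evalMatrix D x₀ T = !![a, b; d, -a] ∧ ∀ y, T.1 y ∘L T.1 y =
          (a ^ 2 + b * d) • ContinuousLinearMap.id ℝ (TangentSpace (𝓡 2) y) := by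
      intro a b d
      obtain ⟨T, hT⟩ := exists_evalMatrix_eq D h x₀ (m := !![a, b; d, -a])
        (by simp [Matrix.trace_fin_two])
      obtain ⟨c, hc, hc'⟩ := exists_comp_self_eq_smul_id D T x₀
      have := hc' x₀
      rw [hT] at this
      refine ⟨T, hT, fun y => ?_⟩
      rw [hc, ← this]
      rfl
    -- A rotation, a reflection and a nilpotent block: `a ^ 2 + b * d` equals `-1`, `1` and `0`
    -- respectively.
    obtain ⟨S, -, hS⟩ := key 0 (-1) 1
    obtain ⟨T, -, hT⟩ := key 1 0 0
    obtain ⟨N, hN0, hN⟩ := key 0 1 0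
    refine ⟨admitsKahler_of_comp_self S (by norm_num) hS,
      admitsParaKahler_of_comp_self T (by norm_num) hT,
      admitsNilpotentKahler_of_comp_self N ?_ (by simpa using hN)⟩
    rintro rfl
    rw [map_zero] at hN0
    simpa using congrFun (congrFun hN0 0) 1
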